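/- Let $d\in\mathbb N$ and let $\mathbb X$ be the space of continuous paths $x:[0,1]\to\mathbb R^d$ with $x(0)=0$ that have a derivative $\dot x\in L^2([0,1];\mathbb R^d)$, i.e. $x_t=\int_0^t\dot x_s\,ds$. Let $\varphi:\mathbb R\to\mathbb R$ be linearly bounded, i.e. $|\varphi(u)|\le M(1+|u|)$ for all $u$ and some $M>0$, and (locally) absolutely continuous with exponentially bounded derivative, i.e. $|\varphi'(u)|\le Ce^{c|u|}$ for almost every $u$ and some constants $C,c$. Let $\sigma_a,\sigma_A>0$ and $\sigma_b\ge 0$. For a positive semidefinite $\Sigma\in\mathbb R^{2\times2}$ put $V_\varphi(\Sigma)=\mathbb E_{(Z_1,Z_2)\sim\mathcal N(0,\Sigma)}[\varphi(Z_1)\varphi(Z_2)]$, and for $R>0$ let $\mathrm{PSD}_2(R)$ be the set of positive semidefinite $\Sigma\in\mathbb R^{2\times 2}$ whose diagonal entries lie in $[1/R,R]$. For a partition $\mathcal D=\{0=t_0<\dots<t_n=1\}$ with mesh $|\mathcal D|=\max_i(t_{i+1}-t_i)$, and $x,y\in\mathbb X$, define the discrete kernels by $\kappa_{\mathcal D}^{x,y}(0)=\sigma_a^2$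 and, for $0\le m<n$ and $t\in(t_m,t_{m+1}]$, $$\kappa_{\mathcal D}^{x,y}(t)=\kappa_{\mathcal D}^{x,y}(t_m)+\big(\sigma_A^2V_\varphi(\Sigma_{\mathcal D}^{x,y}(t_m))+\sigma_b^2\big)\Big\langle\frac{x_t-x_{t_m}}{t-t_m},\frac{y_t-y_{t_m}}{t-t_m}\Big\rangle_{\mathbb R^d}(t-t_m),\qquad \Sigma_{\mathcal D}^{x,y}(t)=\begin{pmatrix}\kappa_{\mathcal D}^{x,x}(t)&\kappa_{\mathcal D}^{x,y}(t)\\ \kappa_{\mathcal D}^{x,y}(t)&\kappa_{\mathcal D}^{y,y}(t)\end{pmatrix}.$$ Then there are continuous functions $\kappa_\varphi^{x,y}:[0,1]\to\mathbb R$, $x,y\in\mathbb X$, such that, with $\Sigma_\varphi^{x,y}=\begin{pmatrix}\kappa_\varphi^{x,x}&\kappa_\varphi^{x,y}\\ \kappa_\varphi^{x,y}&\kappa_\varphi^{y,y}\end{pmatrix}$, the following hold. 1. For all $x,y\in\mathbb X$ and $t\in[0,1]$, the matrix $\Sigma_\varphi^{x,y}(t)$ is positive semidefinite and $$\kappa_\varphi^{x,y}(t)=\sigma_a^2+\int_0^t\big(\sigma_A^2V_\varphi(\Sigma_\varphi^{x,y}(s))+\sigma_b^2\big)\langle\dot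 x_s,\dot y_s\rangle_{\mathbb R^d}\,ds .\qquad(*)$$ The solution is unique: for given $x,y$, any triple of functions $(k^{x,x},k^{x,y},k^{y,y})$ on $[0,1]$ that satisfies $(*)$ for the pairs $(x,x)$, $(x,y)$ and $(y,y)$ (with integrable integrands), and whose matrices $\begin{pmatrix}k^{x,x}(t)&k^{x,y}(t)\\k^{x,y}(t)&k^{y,y}(t)\end{pmatrix}$ are positive semidefinite for all $t\in[0,1]$, equals $(\kappa_\varphi^{x,x},\kappa_\varphi^{x,y},\kappa_\varphi^{y,y})$. 2. For all $x,y\in\mathbb X$ there is $R>0$ such that $\Sigma_\varphi^{x,y}(t)\in\mathrm{PSD}_2(R)$ and $\Sigma_{\mathcal D}^{x,y}(t)\in\mathrm{PSD}_2(R)$ for all $t\in[0,1]$ and all partitions $\mathcal D$. 3. For every sequence $(\mathcal D_M)_{M\in\mathbb N}$ of partitions of $[0,1]$ with $|\mathcal D_M|\to0$ and all $x,y\in\mathbb X$, the functions $\kappa_{\mathcal D_M}^{x,y}$ are continuous and converge to $\kappa_\varphi^{x,y}$ uniformly on $[0,1]$ as $M\to\infty$. -/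

import Mathlib

open MeasureTheory ProbabilityTheory Filter Topology Set

noncomputable section

namespace ControlledResNet

/-- The space `𝕏` of continuous paths `x : [0,1] → ℝ^d` with `x 0 = 0` that have a square
integrable derivative `ẋ`, i.e. `x t = ∫ s in 0..t, ẋ s` for some `ẋ ∈ L²([0,1]; ℝ^d)`. -/
structure PathSpace (d : ℕ) where
  /-- the underlying continuous path -/
  path : C(unitInterval, EuclideanSpace ℝ (Fin d))
  path_zero : path 0 = 0
  exists_deriv : ∃ v : ℝ → EuclideanSpace ℝ (Fin d),
    MemLp v 2 (volume.restrict (Icc (0 : ℝ) 1)) ∧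
      ∀ t : unitInterval, path t = ∫ s in (0 : ℝ)..(t : ℝ), v s

namespace PathSpace

variable {d : ℕ}

/-- The value `x t` of a path at a time `t ∈ [0,1]` given as a real number. -/
def eval (x : PathSpace d) (t : ℝ) : EuclideanSpace ℝ (Fin d) :=
  x.path (projIcc 0 1 zero_le_one t)

/-- The derivative `ẋ ∈ L²([0,1]; ℝ^d)` of a path; it is unique up to null sets, see
`PathSpace.dot_ae_unique`. -/
def dot (x : PathSpace d) : ℝ → EuclideanSpace ℝ (Fin d) := x.exists_deriv.choose

theorem memLp_dot (x : PathSpace d) : MemLp x.dot 2 (volume.restrict (Icc (0 : ℝ) 1)) :=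
  x.exists_deriv.choose_spec.1

theorem eval_eq_integral (x : PathSpace d) {t : ℝ} (ht : t ∈ Icc (0 : ℝ) 1) :
    x.eval t = ∫ s in (0 : ℝ)..t, x.dot s := by
  have h := x.exists_deriv.choose_spec.2 ⟨t, ht⟩
  rw [eval, projIcc_of_mem _ ht]
  exact h

/-- `ẋ` is determined by `x` up to a null set. -/
theorem dot_ae_unique (x : PathSpace d) (v : ℝ → EuclideanSpace ℝ (Fin d))
    (hv : MemLp v 2 (volume.restrict (Icc (0 : ℝ) 1)))
    (hx : ∀ t ∈ Icc (0 : ℝ) 1, x.eval t = ∫ s in (0 : ℝ)..t, v s) :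
    v =ᵐ[volume.restrict (Icc (0 : ℝ) 1)] x.dot := by
  have int : ∀ w : ℝ → EuclideanSpace ℝ (Fin d),
      MemLp w 2 (volume.restrict (Icc (0 : ℝ) 1)) → IntervalIntegrable w volume 0 1 := by
    intro w hw
    rw [intervalIntegrable_iff_integrableOn_Icc_of_le zero_le_one]
    exact hw.integrable (by norm_num)
  have h1 := (int v hv).ae_hasDerivAt_integral
  have h2 := (int _ x.memLp_dot).ae_hasDerivAt_integral
  rw [← restrict_Ioo_eq_restrict_Icc]
  filter_upwards [ae_restrict_of_ae h1, ae_restrict_of_ae h2,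
    ae_restrict_mem measurableSet_Ioo] with t a1 a2 ht
  have m : t ∈ uIcc (0 : ℝ) 1 := by
    rw [uIcc_of_le zero_le_one]; exact Ioo_subset_Icc_self ht
  have b1 := a1 m 0 (by simp)
  have b2 := a2 m 0 (by simp)
  refine b1.unique (b2.congr_of_eventuallyEq ?_)
  filter_upwards [Ioo_mem_nhds ht.1 ht.2] with u hu
  rw [← hx u (Ioo_subset_Icc_self hu), ← x.eval_eq_integral (Ioo_subset_Icc_self hu)]

end PathSpace

/-- A partition `0 = t_0 < t_1 < ⋯ < t_n = 1` of `[0,1]` (only `pt 0, …, pt n` matter). -/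
structure UnitPartition where
  /-- number of intervals -/
  n : ℕ
  /-- the partition points -/
  pt : ℕ → ℝ
  pt_zero : pt 0 = 0
  pt_last : pt n = 1
  strictMonoOn : StrictMonoOn pt (Iic n)

namespace UnitPartition

/-- The mesh `|D| = max_{i < n} (t_{i+1} - t_i)`. -/
def mesh (D : UnitPartition) : ℝ := ⨆ i : Fin D.n, (D.pt ((i : ℕ) + 1) - D.pt (i : ℕ))

open Classical in
/-- The largest `m ≤ n` with `t_m ≤ t`: for `t ∈ [t_m, t_{m+1})` it is `m`, for `t = 1` it
is `n`. -/
def idx (D : UnitPartition) (t : ℝ) : ℕ := Nat.findGreatest (fun i => D.pt i ≤ t) D.n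

end UnitPartition

/-- `φ` is linearly bounded. -/
def LinearlyBounded (φ : ℝ → ℝ) : Prop := ∃ M : ℝ, 0 < M ∧ ∀ x, |φ x| ≤ M * (1 + |x|)

/-- `φ` is absolutely continuous (on every compact interval), and its derivative, which then
exists almost everywhere, is exponentially bounded. -/
def ACExpBoundedDeriv (φ : ℝ → ℝ) : Prop :=
  (∀ a b : ℝ, AbsolutelyContinuousOnInterval φ a b) ∧
    ∃ C c : ℝ, ∀ᵐ x : ℝ, |deriv φ x| ≤ C * Real.exp (c * |x|)

/-- `V_φ(Σ) = 𝔼[φ(Z_1) φ(Z_2)]` for `(Z_1, Z_2) ∼ 𝒩(0, Σ)`, for positive semidefinite `Σ`. -/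
def V (φ : ℝ → ℝ) (S : Matrix (Fin 2) (Fin 2) ℝ) : ℝ :=
  ∫ z, φ (z 0) * φ (z 1) ∂(multivariateGaussian (0 : EuclideanSpace ℝ (Fin 2)) S)

/-- The symmetric `2 × 2` matrix with diagonal `a`, `c` and off-diagonal entry `b`. -/
def cov2 (a b c : ℝ) : Matrix (Fin 2) (Fin 2) ℝ := !![a, b; b, c]

/-- `PSD_2(R)`: positive semidefinite `2 × 2` matrices with diagonal entries in `[1/R, R]`. -/
def PSD2 (R : ℝ) : Set (Matrix (Fin 2) (Fin 2) ℝ) :=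
  {S | S.PosSemidef ∧ ∀ i, 1 / R ≤ S i i ∧ S i i ≤ R}

variable {d : ℕ}

/-- The discrete kernel `κ_D^{x,y}(t_i)` at the partition points. -/
def discreteKernel (φ : ℝ → ℝ) (σa σA σb : ℝ) (D : UnitPartition) :
    ℕ → PathSpace d → PathSpace d → ℝ
  | 0 => fun _ _ => σa ^ 2
  | i + 1 => fun x y =>
      discreteKernel φ σa σA σb D i x y
        + (σA ^ 2 * V φ (cov2 (discreteKernel φ σa σA σb D i x x)
              (discreteKernel φ σa σA σb D i x y) (discreteKernel φ σa σA σb D i y y)) + σb ^ 2)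
          * (inner ℝ (x.eval (D.pt (i + 1)) - x.eval (D.pt i))
                (y.eval (D.pt (i + 1)) - y.eval (D.pt i))
              / (D.pt (i + 1) - D.pt i))

/-- The interpolation `κ_D^{x,y}(t)`, `t ∈ [0,1]`: with `t ∈ [t_m, t_{m+1})`, it is
`κ(t_m) + (σ_A² V_φ(Σ(t_m)) + σ_b²) ⟨(x_t - x_{t_m})/(t - t_m), (y_t - y_{t_m})/(t - t_m)⟩ (t - t_m)`
(the second summand being `0` for `t = t_m`). -/
def interpKernel (φ : ℝ → ℝ) (σa σA σb : ℝ) (D : UnitPartition) (x y : PathSpace d) (t : ℝ) : ℝ :=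
  let m := D.idx t
  let K := discreteKernel (d := d) φ σa σA σb D m
  let τ := t - D.pt m
  K x y + (σA ^ 2 * V φ (cov2 (K x x) (K x y) (K y y)) + σb ^ 2)
    * inner ℝ (τ⁻¹ • (x.eval t - x.eval (D.pt m))) (τ⁻¹ • (y.eval t - y.eval (D.pt m))) * τ

/-- The right-hand side integrand `(σ_A² V_φ(Σ(s)) + σ_b²) ⟨ẋ_s, ẏ_s⟩`, where `Σ` has diagonal
`kxx`, `kyy` and off-diagonal entry `kxy`. -/
def kernelIntegrand (φ : ℝ → ℝ) (σA σb : ℝ) (x y : PathSpace d) (kxx kxy kyy : ℝ → ℝ) (s : ℝ) : ℝ :=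
  (σA ^ 2 * V φ (cov2 (kxx s) (kxy s) (kyy s)) + σb ^ 2) * inner ℝ (x.dot s) (y.dot s)

/-- `kxy(t) = σ_a² + ∫_0^t (σ_A² V_φ(Σ(s)) + σ_b²) ⟨ẋ_s, ẏ_s⟩ ds` for all `t ∈ [0,1]`, the
integral being an absolutely convergent one. -/
def SatisfiesEquation (φ : ℝ → ℝ) (σa σA σb : ℝ) (x y : PathSpace d) (kxx kxy kyy : ℝ → ℝ) :
    Prop :=
  IntervalIntegrable (kernelIntegrand φ σA σb x y kxx kxy kyy) volume 0 1 ∧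
    ∀ t ∈ Icc (0 : ℝ) 1,
      kxy t = σa ^ 2 + ∫ s in (0 : ℝ)..t, kernelIntegrand φ σA σb x y kxx kxy kyy s

/-- `(kxx, kxy, kyy)` solves the system formed by the kernel equation for the pairs `(x,x)`,
`(x,y)` and `(y,y)`, with `Σ(t)` positive semidefinite at all times, so that `V_φ(Σ(t))` is
meaningful. -/
structure IsKernelSolution (φ : ℝ → ℝ) (σa σA σb : ℝ) (x y : PathSpace d)
    (kxx kxy kyy : ℝ → ℝ) : Prop where
  posSemidef : ∀ t ∈ Icc (0 : ℝ) 1, (cov2 (kxx t) (kxy t) (kyy t)).PosSemidef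
  eq_xx : SatisfiesEquation φ σa σA σb x x kxx kxx kxx
  eq_xy : SatisfiesEquation φ σa σA σb x y kxx kxy kyy
  eq_yy : SatisfiesEquation φ σa σA σb y y kyy kyy kyy

end ControlledResNet

end

/-!
The kernel equation is a Volterra equation with weight `⟨ẋ, ẏ⟩ ∈ L¹`, and the discrete kernels are
its Euler scheme. The statement follows from three facts.

*Regularity of `V_φ`.* On positive semidefinite matrices with diagonal entries in `[1/R, R]` the
function `V_φ` is Lipschitz up to the boundary of the cone (`ExpLipschitz.exists_V_lipschitz`).
Write `V_φ(Σ) = 𝔼[φ(p ⬝ W) φ(q ⬝ W)]` for plane vectors `p`, `q` with Gram matrix `Σ` and a standard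
Gaussian pair `W`. Changing the lengths of `p` and `q` is harmless, since the local Lipschitz
constants of `φ` grow at most exponentially. To change the angle, choose coordinates in which the
two positions of `q` are mirror images `q`, `q*`. Averaging with the reflected configuration gives
`2 (𝔼[φ(p ⬝ W) φ(q ⬝ W)] - 𝔼[φ(p ⬝ W) φ(q* ⬝ W)])
  = 𝔼[(φ(p ⬝ W) - φ(p* ⬝ W)) (φ(q ⬝ W) - φ(q* ⬝ W))]`,
a product of two increments of size `|p₂|` and `|q₂|`; and `2 p₂ q₂` is, up to sign, the change of
the covariance (`ExpLipschitz.abs_gramExp_sub_reflect_le`).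

*Consistency.* The discrete covariance matrices are positive semidefinite, because Gram matrices
and their Hadamard products are, and linear growth of `φ` confines them to one `PSD_2(R)` for all
partitions (`exists_interpKernel_mem_PSD2`). The interpolated kernels satisfy the kernel equation up
to an error that vanishes with the mesh (`interpKernel_defect_le`): replacing the integral of
`⟨ẋ, ẏ⟩` over a short interval by `⟨Δx, Δy⟩ / Δt` costs the `L²` distance of `ẋ` and `ẏ` to their
means, and this is small in total since `ẋ` and `ẏ` are `L²` limits of continuous functions.

*Stability.* By Grönwall's inequality with an integrable weight, two approximate solutions in
`PSD_2(R)` differ by a multiple of their errors (`exists_stability_const`). Hence the interpolated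
kernels converge uniformly as the mesh tends to `0`, the limit solves the equation, and the solution
is unique, every solution being confined to some `PSD_2(R)` by continuity.
-/

namespace ControlledResNet

/-! ### Gaussian pairs and Gram matrices -/

/-- The law of a pair of independent standard Gaussian variables. -/
noncomputable def stdPair : Measure (ℝ × ℝ) := (gaussianReal 0 1).prod (gaussianReal 0 1)

instance : IsProbabilityMeasure stdPair := by unfold stdPair; infer_instance

/-- `𝔼[φ(p ⬝ W) φ(q ⬝ W)]` for a standard Gaussian pair `W`. -/
noncomputable def gramExp (φ : ℝ → ℝ) (p q : ℝ × ℝ) : ℝ :=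
  ∫ w, φ (p.1 * w.1 + p.2 * w.2) * φ (q.1 * w.1 + q.2 * w.2) ∂stdPair

theorem gramExp_comm (φ : ℝ → ℝ) (p q : ℝ × ℝ) : gramExp φ p q = gramExp φ q p := by
  simp only [gramExp, mul_comm]

theorem cov2_posSemidef_iff {a b c : ℝ} :
    (cov2 a b c).PosSemidef ↔ 0 ≤ a ∧ 0 ≤ c ∧ b ^ 2 ≤ a * c := by
  constructor
  · intro h
    refine ⟨by simpa [cov2] using h.diag_nonneg (i := 0),
      by simpa [cov2] using h.diag_nonneg (i := 1), ?_⟩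
    have := h.det_nonneg
    simp [cov2, Matrix.det_fin_two] at this
    nlinarith
  · rintro ⟨ha, hc, hb⟩
    refine Matrix.PosSemidef.of_dotProduct_mulVec_nonneg ?_ fun x => ?_
    · ext i j
      fin_cases i <;> fin_cases j <;> simp [cov2, Matrix.conjTranspose]
    · simp only [cov2, dotProduct, Matrix.mulVec, Fin.sum_univ_two, Pi.star_apply, star_trivial,
        Matrix.of_apply, Matrix.cons_val', Matrix.cons_val_zero, Matrix.cons_val_one,
        Matrix.cons_val_fin_one]
      rcases ha.eq_or_lt with h0 | h0
      · have : b = 0 := by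
          rw [← h0, zero_mul] at hb
          exact pow_eq_zero_iff two_ne_zero |>.1 (le_antisymm hb (sq_nonneg b))
        subst this
        rw [← h0]
        nlinarith [mul_nonneg hc (sq_nonneg (x 1))]
      · have : 0 ≤ a * (x 0 * (a * x 0 + b * x 1) + x 1 * (b * x 0 + c * x 1)) := by
          nlinarith [sq_nonneg (a * x 0 + b * x 1),
            mul_nonneg (sub_nonneg.2 hb) (sq_nonneg (x 1))]
        exact nonneg_of_mul_nonneg_right this h0

/-- Every positive semidefinite `2 × 2` matrix is a Gram matrix of two plane vectors. -/
theorem exists_gram {a b c : ℝ} (ha : 0 ≤ a) (hc : 0 ≤ c) (hb : b ^ 2 ≤ a * c) :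
    ∃ p q : ℝ × ℝ, p.1 ^ 2 + p.2 ^ 2 = a ∧ p.1 * q.1 + p.2 * q.2 = b ∧
      q.1 ^ 2 + q.2 ^ 2 = c := by
  rcases ha.eq_or_lt with h0 | h0
  · have : b = 0 := by
      rw [← h0, zero_mul] at hb
      exact pow_eq_zero_iff two_ne_zero |>.1 (le_antisymm hb (sq_nonneg b))
    exact ⟨(0, 0), (√c, 0), by simp [← h0], by simp [this], by simp [Real.sq_sqrt hc]⟩
  · have h1 : 0 ≤ c - b ^ 2 / a := by
      rw [sub_nonneg, div_le_iff₀ h0]; linarith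
    have h2 : √a ≠ 0 := (Real.sqrt_pos.2 h0).ne'
    refine ⟨(√a, 0), (b / √a, √(c - b ^ 2 / a)), by simp [Real.sq_sqrt ha], ?_, ?_⟩
    · simp; field_simp
    · simp only [div_pow, Real.sq_sqrt ha, Real.sq_sqrt h1]; ring

theorem measurable_toLp_dot (p q : ℝ × ℝ) : Measurable (fun w : ℝ × ℝ =>
    (WithLp.toLp 2 ![p.1 * w.1 + p.2 * w.2, q.1 * w.1 + q.2 * w.2] :
      EuclideanSpace ℝ (Fin 2))) := by
  refine Continuous.measurable ?_
  refine (PiLp.continuous_toLp 2 _).comp (continuous_pi fun i => ?_)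
  fin_cases i <;> simp <;> fun_prop

/-- The law of `(p ⬝ W, q ⬝ W)` is the centered Gaussian law whose covariance is the Gram matrix
of `p` and `q`. -/
theorem map_stdPair_eq_multivariateGaussian (p q : ℝ × ℝ) :
    stdPair.map (fun w => WithLp.toLp 2 ![p.1 * w.1 + p.2 * w.2, q.1 * w.1 + q.2 * w.2]) =
      multivariateGaussian (0 : EuclideanSpace ℝ (Fin 2))
        (cov2 (p.1 ^ 2 + p.2 ^ 2) (p.1 * q.1 + p.2 * q.2) (q.1 ^ 2 + q.2 ^ 2)) := by
  have hm := measurable_toLp_dot p q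
  have : IsProbabilityMeasure (stdPair.map (fun w : ℝ × ℝ =>
      (WithLp.toLp 2 ![p.1 * w.1 + p.2 * w.2, q.1 * w.1 + q.2 * w.2] :
        EuclideanSpace ℝ (Fin 2)))) := Measure.isProbabilityMeasure_map hm.aemeasurable
  refine Measure.ext_of_charFun ?_
  ext t
  rw [charFun_multivariateGaussian (cov2_posSemidef_iff.2
    ⟨by positivity, by positivity, by nlinarith [sq_nonneg (p.1 * q.2 - p.2 * q.1)]⟩),
    charFun_apply, integral_map hm.aemeasurable (by fun_prop)]
  have h1 : ∀ w : ℝ × ℝ, Complex.exp ((inner ℝ (WithLp.toLp 2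
        ![p.1 * w.1 + p.2 * w.2, q.1 * w.1 + q.2 * w.2] : EuclideanSpace ℝ (Fin 2)) t : ℝ)
          * Complex.I) =
      Complex.exp (((t 0 * p.1 + t 1 * q.1 : ℝ)) * (w.1 : ℂ) * Complex.I) *
      Complex.exp (((t 0 * p.2 + t 1 * q.2 : ℝ)) * (w.2 : ℂ) * Complex.I) := by
    intro w
    rw [← Complex.exp_add]
    congr 1
    simp [PiLp.inner_apply, Fin.sum_univ_two]
    ring
  simp_rw [h1]
  rw [stdPair, integral_prod_mul
    (fun x : ℝ => Complex.exp (((t 0 * p.1 + t 1 * q.1 : ℝ)) * (x : ℂ) * Complex.I))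
    (fun y : ℝ => Complex.exp (((t 0 * p.2 + t 1 * q.2 : ℝ)) * (y : ℂ) * Complex.I)),
    ← charFun_apply_real, ← charFun_apply_real,
    charFun_gaussianReal, charFun_gaussianReal, ← Complex.exp_add]
  congr 1
  simp [cov2, dotProduct, Matrix.mulVec, Fin.sum_univ_two]
  ring

theorem V_cov2_gram {φ : ℝ → ℝ} (hφ : Measurable φ) (p q : ℝ × ℝ) :
    V φ (cov2 (p.1 ^ 2 + p.2 ^ 2) (p.1 * q.1 + p.2 * q.2) (q.1 ^ 2 + q.2 ^ 2)) =
      gramExp φ p q := by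
  have hm := measurable_toLp_dot p q
  rw [V, ← map_stdPair_eq_multivariateGaussian, integral_map hm.aemeasurable]
  · simp [gramExp]
  · exact Measurable.aestronglyMeasurable
      ((hφ.comp (by fun_prop)).mul (hφ.comp (by fun_prop)))

theorem integrable_exp_stdPair (k : ℝ) :
    Integrable (fun w : ℝ × ℝ => Real.exp (k * (|w.1| + |w.2|))) stdPair := by
  have h : Integrable (fun x : ℝ => Real.exp (k * |x|)) (gaussianReal 0 1) :=
    integrable_exp_mul_abs (X := fun x : ℝ => x) (integrable_exp_mul_gaussianReal k)
      (integrable_exp_mul_gaussianReal (-k))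
  have := h.mul_prod h
  simpa only [mul_add, Real.exp_add, stdPair] using this

/-! ### Exponentially Lipschitz functions of Gaussian pairs -/

/-- `φ` grows at most exponentially and is locally Lipschitz with exponentially growing local
Lipschitz constants. -/
structure ExpLipschitz (φ : ℝ → ℝ) (C c : ℝ) : Prop where
  C_nonneg : 0 ≤ C
  c_nonneg : 0 ≤ c
  continuous : Continuous φ
  abs_apply_le : ∀ u, |φ u| ≤ C * Real.exp (c * |u|)
  abs_apply_sub_le : ∀ u v, |φ u - φ v| ≤ C * |u - v| * Real.exp (c * (|u| + |v|))

/-- The fundamental theorem of calculus turns the bound on `φ'` into a bound on increments. -/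
theorem exists_expLipschitz {φ : ℝ → ℝ} (hlin : LinearlyBounded φ) (hac : ACExpBoundedDeriv φ) :
    ∃ C c, ExpLipschitz φ C c := by
  obtain ⟨M, hM, hφ⟩ := hlin
  obtain ⟨hac, C, c, hd⟩ := hac
  refine ⟨|C| + M, |c| + 1, by positivity, by positivity, ?_, ?_, ?_⟩
  · refine continuous_iff_continuousAt.2 fun x => ?_
    refine (hac (x - 1) (x + 1)).continuousOn.continuousAt ?_
    rw [uIcc_of_le (by linarith)]
    exact Icc_mem_nhds (by linarith) (by linarith)
  · intro u
    refine (hφ u).trans ?_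
    have h1 : 1 + |u| ≤ Real.exp |u| := by linarith [Real.add_one_le_exp |u|]
    have h2 : Real.exp |u| ≤ Real.exp ((|c| + 1) * |u|) := by
      apply Real.exp_le_exp.2; nlinarith [abs_nonneg u, abs_nonneg c]
    have : 0 ≤ 1 + |u| := by positivity
    gcongr
    · linarith [abs_nonneg C]
    · exact h1.trans h2
  · intro u v
    rw [← (hac v u).integral_deriv_eq_sub]
    have h : ‖∫ x in v..u, deriv φ x‖ ≤
        ((|C| + M) * Real.exp ((|c| + 1) * (|u| + |v|))) * |u - v| := by
      refine intervalIntegral.norm_integral_le_of_norm_le_const_ae ?_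
      filter_upwards [hd] with x hx hxm
      have h1 : |x| ≤ |u| + |v| := by
        rcases le_total v u with h | h
        · rw [uIoc_of_le h] at hxm
          rcases abs_cases x with h1 | h1 <;> rcases abs_cases u with h2 | h2 <;>
            rcases abs_cases v with h3 | h3 <;> linarith [hxm.1, hxm.2]
        · rw [uIoc_of_ge h] at hxm
          rcases abs_cases x with h1 | h1 <;> rcases abs_cases u with h2 | h2 <;>
            rcases abs_cases v with h3 | h3 <;> linarith [hxm.1, hxm.2]
      have h2 : c * |x| ≤ (|c| + 1) * (|u| + |v|) := by
        have h3 : c * |x| ≤ |c| * |x| := by gcongr; exact le_abs_self c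
        have h4 : |c| * |x| ≤ (|c| + 1) * (|u| + |v|) := by gcongr; linarith
        linarith
      rw [Real.norm_eq_abs]
      refine hx.trans ?_
      gcongr
      linarith [le_abs_self C]
    rw [Real.norm_eq_abs] at h
    linarith

section Gram

variable {φ : ℝ → ℝ} {C c : ℝ}

theorem abs_dot_le {S : ℝ} {p : ℝ × ℝ} (h1 : |p.1| ≤ S) (h2 : |p.2| ≤ S) (w : ℝ × ℝ) :
    |p.1 * w.1 + p.2 * w.2| ≤ S * (|w.1| + |w.2|) := by
  refine (abs_add_le _ _).trans ?_
  rw [abs_mul, abs_mul, mul_add]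
  gcongr

theorem ExpLipschitz.abs_comp_dot_le (hφ : ExpLipschitz φ C c) {S : ℝ} {p : ℝ × ℝ}
    (h1 : |p.1| ≤ S) (h2 : |p.2| ≤ S) (w : ℝ × ℝ) :
    |φ (p.1 * w.1 + p.2 * w.2)| ≤ C * Real.exp (c * S * (|w.1| + |w.2|)) := by
  refine (hφ.abs_apply_le _).trans ?_
  have := hφ.C_nonneg
  have := hφ.c_nonneg
  rw [mul_assoc c]
  gcongr
  exact abs_dot_le h1 h2 w

theorem ExpLipschitz.abs_comp_dot_sub_le (hφ : ExpLipschitz φ C c) {S : ℝ} {p q : ℝ × ℝ}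
    (h1 : |p.1| ≤ S) (h2 : |p.2| ≤ S) (h3 : |q.1| ≤ S) (h4 : |q.2| ≤ S) (w : ℝ × ℝ) :
    |φ (p.1 * w.1 + p.2 * w.2) - φ (q.1 * w.1 + q.2 * w.2)| ≤
      C * (|p.1 - q.1| + |p.2 - q.2|) * (|w.1| + |w.2|) *
        Real.exp (2 * c * S * (|w.1| + |w.2|)) := by
  refine (hφ.abs_apply_sub_le _ _).trans ?_
  have := hφ.C_nonneg
  have := hφ.c_nonneg
  have h5 := abs_dot_le h1 h2 w
  have h6 := abs_dot_le h3 h4 w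
  have h7 : |p.1 * w.1 + p.2 * w.2 - (q.1 * w.1 + q.2 * w.2)| ≤
      (|p.1 - q.1| + |p.2 - q.2|) * (|w.1| + |w.2|) := by
    have := abs_dot_le (S := |p.1 - q.1| + |p.2 - q.2|) (p := (p.1 - q.1, p.2 - q.2))
      (by simp) (by simp) w
    refine le_trans (le_of_eq ?_) this
    congr 1; simp only; ring
  have h8 : c * (|p.1 * w.1 + p.2 * w.2| + |q.1 * w.1 + q.2 * w.2|) ≤
      2 * c * S * (|w.1| + |w.2|) := by nlinarith
  rw [mul_assoc C (_ + _)]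
  gcongr

theorem ExpLipschitz.integrable_gram (hφ : ExpLipschitz φ C c) (p q : ℝ × ℝ) :
    Integrable (fun w : ℝ × ℝ =>
      φ (p.1 * w.1 + p.2 * w.2) * φ (q.1 * w.1 + q.2 * w.2)) stdPair := by
  set S := |p.1| + |p.2| + |q.1| + |q.2|
  refine ((integrable_exp_stdPair (2 * c * S)).const_mul (C ^ 2)).mono' ?_ ?_
  · have := hφ.continuous
    exact Continuous.aestronglyMeasurable (by fun_prop)
  · refine Eventually.of_forall fun w => ?_
    have h1 := hφ.abs_comp_dot_le (S := S) (p := p) (by grind [abs_nonneg])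
      (by grind [abs_nonneg]) w
    have h2 := hφ.abs_comp_dot_le (S := S) (p := q) (by grind [abs_nonneg])
      (by grind [abs_nonneg]) w
    rw [Real.norm_eq_abs, abs_mul]
    refine (mul_le_mul h1 h2 (abs_nonneg _) (by have := hφ.C_nonneg; positivity)).trans
      (le_of_eq ?_)
    rw [show 2 * c * S * (|w.1| + |w.2|) =
      c * S * (|w.1| + |w.2|) + c * S * (|w.1| + |w.2|) by ring,
      Real.exp_add]
    ring

/-- The exponential moment of `|W₁| + |W₂|` for a standard Gaussian pair `W`. -/
noncomputable def expMoment (k : ℝ) : ℝ := ∫ w : ℝ × ℝ, Real.exp (k * (|w.1| + |w.2|)) ∂stdPair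

theorem expMoment_nonneg (k : ℝ) : 0 ≤ expMoment k :=
  integral_nonneg fun _ => (Real.exp_pos _).le

theorem ExpLipschitz.abs_gramExp_sub_le (hφ : ExpLipschitz φ C c) {S : ℝ} {p p' q : ℝ × ℝ}
    (h1 : |p.1| ≤ S) (h2 : |p.2| ≤ S) (h3 : |p'.1| ≤ S) (h4 : |p'.2| ≤ S)
    (h5 : |q.1| ≤ S) (h6 : |q.2| ≤ S) :
    |gramExp φ p q - gramExp φ p' q| ≤
      C ^ 2 * (|p.1 - p'.1| + |p.2 - p'.2|) * expMoment (3 * c * S + 1) := by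
  rw [gramExp, gramExp, ← integral_sub (hφ.integrable_gram p q) (hφ.integrable_gram p' q),
    expMoment, ← integral_const_mul, ← Real.norm_eq_abs]
  refine norm_integral_le_of_norm_le ((integrable_exp_stdPair _).const_mul _)
    (Eventually.of_forall fun w => ?_)
  rw [← sub_mul, Real.norm_eq_abs, abs_mul]
  have a1 := hφ.abs_comp_dot_sub_le h1 h2 h3 h4 w
  have a2 := hφ.abs_comp_dot_le h5 h6 w
  have hC := hφ.C_nonneg
  refine (mul_le_mul a1 a2 (abs_nonneg _) (by positivity)).trans ?_
  set N := |w.1| + |w.2|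
  have hN : 0 ≤ N := by positivity
  have e : Real.exp ((3 * c * S + 1) * N) =
      Real.exp (2 * c * S * N) * Real.exp (c * S * N) * Real.exp N := by
    rw [← Real.exp_add, ← Real.exp_add]; ring_nf
  rw [e]
  have : N ≤ Real.exp N := by linarith [Real.add_one_le_exp N]
  calc C * (|p.1 - p'.1| + |p.2 - p'.2|) * N * Real.exp (2 * c * S * N) *
        (C * Real.exp (c * S * N))
      = C ^ 2 * (|p.1 - p'.1| + |p.2 - p'.2|) *
        (Real.exp (2 * c * S * N) * Real.exp (c * S * N) * N) := by ring
    _ ≤ _ := by gcongr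

/-- Reflection of the second coordinate preserves the standard Gaussian law. -/
theorem gramExp_reflect (φ : ℝ → ℝ) (p q : ℝ × ℝ) :
    gramExp φ (p.1, -p.2) (q.1, -q.2) = gramExp φ p q := by
  have h : MeasurePreserving (fun w : ℝ × ℝ => (w.1, -w.2)) stdPair stdPair := by
    have h2 : MeasurePreserving (fun x : ℝ => -x) (gaussianReal 0 1) (gaussianReal 0 1) :=
      ⟨measurable_neg, by rw [gaussianReal_map_neg, neg_zero]⟩
    exact (MeasurePreserving.id _).prod h2
  have he : MeasurableEmbedding (fun w : ℝ × ℝ => (w.1, -w.2)) :=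
    ((Homeomorph.refl ℝ).prodCongr (Homeomorph.neg ℝ)).measurableEmbedding
  rw [gramExp, gramExp, ← h.integral_comp he]
  simp

/-- A change of the correlation alone. The vectors `q` and its reflection have the same norm, and
they differ only in the scalar product with `p`. Averaging with the reflected configuration turns
the difference into the expectation of a product of two increments of `φ`, one proportional to
`p.2` and one to `q.2`. -/
theorem ExpLipschitz.abs_gramExp_sub_reflect_le (hφ : ExpLipschitz φ C c) {S : ℝ} {p q : ℝ × ℝ}
    (h1 : |p.1| ≤ S) (h2 : |p.2| ≤ S) (h3 : |q.1| ≤ S) (h4 : |q.2| ≤ S) :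
    |gramExp φ p q - gramExp φ p (q.1, -q.2)| ≤
      4 * C ^ 2 * |p.2 * q.2| * expMoment (4 * c * S + 1) := by
  have r1 := gramExp_reflect φ p q
  have r2 := gramExp_reflect φ p (q.1, -q.2)
  simp only [neg_neg] at r2
  have key : gramExp φ p q - gramExp φ p (q.1, -q.2) =
      ∫ w, (1 / 2) * ((φ (p.1 * w.1 + p.2 * w.2) - φ (p.1 * w.1 + -p.2 * w.2)) *
        (φ (q.1 * w.1 + q.2 * w.2) - φ (q.1 * w.1 + -q.2 * w.2))) ∂stdPair := by
    have i1 := hφ.integrable_gram p q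
    have i2 := hφ.integrable_gram p (q.1, -q.2)
    have i3 := hφ.integrable_gram (p.1, -p.2) q
    have i4 := hφ.integrable_gram (p.1, -p.2) (q.1, -q.2)
    rw [integral_const_mul]
    have : ∀ w : ℝ × ℝ, (φ (p.1 * w.1 + p.2 * w.2) - φ (p.1 * w.1 + -p.2 * w.2)) *
        (φ (q.1 * w.1 + q.2 * w.2) - φ (q.1 * w.1 + -q.2 * w.2)) =
        (φ (p.1 * w.1 + p.2 * w.2) * φ (q.1 * w.1 + q.2 * w.2) -
          φ (p.1 * w.1 + p.2 * w.2) * φ (q.1 * w.1 + -q.2 * w.2)) -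
        (φ (p.1 * w.1 + -p.2 * w.2) * φ (q.1 * w.1 + q.2 * w.2) -
          φ (p.1 * w.1 + -p.2 * w.2) * φ (q.1 * w.1 + -q.2 * w.2)) := fun w => by ring
    simp_rw [this]
    have e := integral_sub (i1.sub i2) (i3.sub i4)
    simp only [Pi.sub_apply] at e
    rw [e, integral_sub i1 i2, integral_sub i3 i4]
    simp only [gramExp] at r1 r2 ⊢
    linarith
  rw [key, expMoment, ← integral_const_mul, ← Real.norm_eq_abs]
  refine norm_integral_le_of_norm_le ((integrable_exp_stdPair _).const_mul _)
    (Eventually.of_forall fun w => ?_)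
  have hC := hφ.C_nonneg
  have a1 := hφ.abs_comp_dot_sub_le (q := (p.1, -p.2)) h1 h2 h1 (by simpa using h2) w
  have a2 := hφ.abs_comp_dot_sub_le (q := (q.1, -q.2)) h3 h4 h3 (by simpa using h4) w
  simp only [sub_self, abs_zero, zero_add, sub_neg_eq_add, ← two_mul, abs_mul, abs_two] at a1 a2
  rw [Real.norm_eq_abs, abs_mul, abs_mul, abs_of_pos (by norm_num : (0 : ℝ) < 1 / 2)]
  refine (mul_le_mul_of_nonneg_left (mul_le_mul a1 a2 (abs_nonneg _) (by positivity))
    (by norm_num)).trans ?_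
  set N := |w.1| + |w.2|
  have hN : 0 ≤ N := by positivity
  have e : Real.exp ((4 * c * S + 1) * N) =
      Real.exp (2 * c * S * N) * Real.exp (2 * c * S * N) * Real.exp N := by
    rw [← Real.exp_add, ← Real.exp_add]; ring_nf
  rw [e, abs_mul]
  have : N ^ 2 ≤ 2 * Real.exp N := by linarith [Real.quadratic_le_exp_of_nonneg hN]
  calc 1 / 2 * (C * (2 * |p.2|) * N * Real.exp (2 * c * S * N) *
        (C * (2 * |q.2|) * N * Real.exp (2 * c * S * N)))
      = 2 * C ^ 2 * (|p.2| * |q.2|) *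
        (Real.exp (2 * c * S * N) * Real.exp (2 * c * S * N)) * N ^ 2 := by ring
    _ ≤ 2 * C ^ 2 * (|p.2| * |q.2|) *
        (Real.exp (2 * c * S * N) * Real.exp (2 * c * S * N)) * (2 * Real.exp N) := by gcongr
    _ = _ := by ring

end Gram

/-! ### The function `V_φ` on covariance matrices -/

section Kernel

variable {φ : ℝ → ℝ} {C c : ℝ}

theorem V_gram_eq {φ : ℝ → ℝ} (hφ : Measurable φ) {a b c : ℝ} {p q : ℝ × ℝ}
    (h1 : p.1 ^ 2 + p.2 ^ 2 = a) (h2 : p.1 * q.1 + p.2 * q.2 = b) (h3 : q.1 ^ 2 + q.2 ^ 2 = c) :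
    V φ (cov2 a b c) = gramExp φ p q := by
  rw [← h1, ← h2, ← h3, V_cov2_gram hφ]

theorem gramExp_self_nonneg (φ : ℝ → ℝ) (p : ℝ × ℝ) : 0 ≤ gramExp φ p p :=
  integral_nonneg fun _ => mul_self_nonneg _

theorem ExpLipschitz.gramExp_sq_le (hφ : ExpLipschitz φ C c) (p q : ℝ × ℝ) :
    gramExp φ p q ^ 2 ≤ gramExp φ p p * gramExp φ q q := by
  have key : ∀ s : ℝ, 0 ≤ gramExp φ q q * (s * s) + (2 * gramExp φ p q) * s + gramExp φ p p := by
    intro s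
    have h : 0 ≤ ∫ w : ℝ × ℝ, (s * φ (q.1 * w.1 + q.2 * w.2) + φ (p.1 * w.1 + p.2 * w.2)) ^ 2
        ∂stdPair := integral_nonneg fun w => sq_nonneg _
    have e : ∀ w : ℝ × ℝ, (s * φ (q.1 * w.1 + q.2 * w.2) + φ (p.1 * w.1 + p.2 * w.2)) ^ 2 =
        (s * s) * (φ (q.1 * w.1 + q.2 * w.2) * φ (q.1 * w.1 + q.2 * w.2)) +
        (2 * s) * (φ (p.1 * w.1 + p.2 * w.2) * φ (q.1 * w.1 + q.2 * w.2)) +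
        φ (p.1 * w.1 + p.2 * w.2) * φ (p.1 * w.1 + p.2 * w.2) := fun w => by ring
    simp_rw [e] at h
    have i1 := (hφ.integrable_gram q q).const_mul (s * s)
    have i2 := (hφ.integrable_gram p q).const_mul (2 * s)
    have i3 := hφ.integrable_gram p p
    have e1 := integral_add (i1.add i2) i3
    simp only [Pi.add_apply] at e1
    rw [e1, integral_add i1 i2, integral_const_mul, integral_const_mul] at h
    simp only [gramExp]
    linarith
  have := discrim_le_zero key
  rw [discrim] at this
  nlinarith

theorem ExpLipschitz.V_self_nonneg (hφ : ExpLipschitz φ C c) {a : ℝ} (ha : 0 ≤ a) :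
    0 ≤ V φ (cov2 a a a) := by
  rw [V_gram_eq hφ.continuous.measurable (p := (√a, 0)) (q := (√a, 0))]
  · exact gramExp_self_nonneg φ _
  all_goals simp [Real.sq_sqrt ha, Real.mul_self_sqrt ha]

/-- The Cauchy–Schwarz inequality for the covariance of `φ(Z₁)` and `φ(Z₂)`. -/
theorem ExpLipschitz.V_sq_le (hφ : ExpLipschitz φ C c) {a b c : ℝ}
    (h : (cov2 a b c).PosSemidef) :
    V φ (cov2 a b c) ^ 2 ≤ V φ (cov2 a a a) * V φ (cov2 c c c) := by
  obtain ⟨ha, hc, hb⟩ := cov2_posSemidef_iff.1 h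
  obtain ⟨p, q, h1, h2, h3⟩ := exists_gram ha hc hb
  have hm := hφ.continuous.measurable
  rw [V_gram_eq hm h1 h2 h3, V_gram_eq hm h1 (by linarith) h1, V_gram_eq hm h3 (by linarith) h3]
  exact hφ.gramExp_sq_le p q

/-- Linear growth of the variance `𝔼[φ(√a Z)²]`. -/
theorem exists_V_self_le (hlin : LinearlyBounded φ) (hφ : ExpLipschitz φ C c) :
    ∃ K, 0 ≤ K ∧ ∀ a, 0 ≤ a → V φ (cov2 a a a) ≤ K * (1 + a) := by
  obtain ⟨M, hM, hb⟩ := hlin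
  set J := ∫ w : ℝ × ℝ, w.1 ^ 2 ∂stdPair
  have hJ : 0 ≤ J := integral_nonneg fun w => sq_nonneg _
  have hJi : Integrable (fun w : ℝ × ℝ => w.1 ^ 2) stdPair := by
    refine ((integrable_exp_stdPair 1).const_mul 2).mono' (by fun_prop)
      (Eventually.of_forall fun w => ?_)
    have h1 : |w.1| ≤ |w.1| + |w.2| := by linarith [abs_nonneg w.2]
    have h2 := Real.quadratic_le_exp_of_nonneg (abs_nonneg w.1)
    have h3 := Real.exp_le_exp.2 h1
    rw [one_mul, Real.norm_eq_abs, abs_of_nonneg (sq_nonneg _), ← sq_abs]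
    linarith [abs_nonneg w.1]
  refine ⟨2 * M ^ 2 * (1 + J), by positivity, fun a ha => ?_⟩
  rw [V_gram_eq hφ.continuous.measurable (p := (√a, 0)) (q := (√a, 0))
    (by simp [Real.sq_sqrt ha]) (by simp [Real.mul_self_sqrt ha]) (by simp [Real.sq_sqrt ha])]
  have h1 : gramExp φ (√a, 0) (√a, 0) ≤ ∫ w : ℝ × ℝ, 2 * M ^ 2 * (1 + a * w.1 ^ 2) ∂stdPair := by
    refine integral_mono (hφ.integrable_gram _ _)
      (((integrable_const 1).add (hJi.const_mul a)).const_mul _) fun w => ?_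
    simp only [zero_mul, add_zero]
    have h2 : |φ (√a * w.1)| ^ 2 ≤ (M * (1 + |√a * w.1|)) ^ 2 := by
      gcongr; exact hb _
    have h3 : |√a * w.1| ^ 2 = a * w.1 ^ 2 := by rw [sq_abs, mul_pow, Real.sq_sqrt ha]
    rw [sq_abs] at h2
    nlinarith [mul_nonneg (sq_nonneg M) (sq_nonneg (1 - |√a * w.1|))]
  refine h1.trans ?_
  rw [integral_const_mul, integral_add (integrable_const 1) (hJi.const_mul a), integral_const_mul]
  simp only [integral_const, probReal_univ, smul_eq_mul, mul_one]
  change 2 * M ^ 2 * (1 + a * J) ≤ _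
  nlinarith [mul_nonneg (sq_nonneg M) (add_nonneg hJ ha)]

/-- The vectors `s (cos α, - sin α)` and `r (cos δ, ± sin δ)` have the scalar products
`s r cos (α ± δ)`; the estimate moves the two lengths one after the other, and then the angle. -/
theorem ExpLipschitz.abs_gramExp_polar_sub_le (hφ : ExpLipschitz φ C c) {S s r s' r' : ℝ} (α δ : ℝ)
    (hs : |s| ≤ S) (hr : |r| ≤ S) (hs' : |s'| ≤ S) (hr' : |r'| ≤ S) :
    |gramExp φ (s * Real.cos α, s * -Real.sin α) (r * Real.cos δ, r * Real.sin δ) -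
      gramExp φ (s' * Real.cos α, s' * -Real.sin α) (r' * Real.cos δ, -(r' * Real.sin δ))| ≤
      2 * C ^ 2 * expMoment (3 * c * S + 1) * (|s - s'| + |r - r'|) +
        2 * C ^ 2 * expMoment (4 * c * S + 1) * |2 * (s' * Real.sin α * (r' * Real.sin δ))| := by
  have bd : ∀ {s t : ℝ}, |s| ≤ S → |t| ≤ 1 → |s * t| ≤ S := by
    intro s t h1 h2
    rw [abs_mul]
    exact (mul_le_of_le_one_right (abs_nonneg _) h2).trans h1
  have bα := Real.abs_cos_le_one α
  have bα' : |-Real.sin α| ≤ 1 := by rw [abs_neg]; exact Real.abs_sin_le_one α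
  have bδ := Real.abs_cos_le_one δ
  have bδ' := Real.abs_sin_le_one δ
  have F1 := hφ.abs_gramExp_sub_le (S := S) (p := (s * Real.cos α, s * -Real.sin α))
    (p' := (s' * Real.cos α, s' * -Real.sin α)) (q := (r * Real.cos δ, r * Real.sin δ))
    (bd hs bα) (bd hs bα') (bd hs' bα) (bd hs' bα') (bd hr bδ) (bd hr bδ')
  have F2 := hφ.abs_gramExp_sub_le (S := S) (p := (r * Real.cos δ, r * Real.sin δ))
    (p' := (r' * Real.cos δ, r' * Real.sin δ)) (q := (s' * Real.cos α, s' * -Real.sin α))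
    (bd hr bδ) (bd hr bδ') (bd hr' bδ) (bd hr' bδ') (bd hs' bα) (bd hs' bα')
  have F3 := hφ.abs_gramExp_sub_reflect_le (S := S) (p := (s' * Real.cos α, s' * -Real.sin α))
    (q := (r' * Real.cos δ, r' * Real.sin δ)) (bd hs' bα) (bd hs' bα') (bd hr' bδ) (bd hr' bδ')
  have hJ1 := expMoment_nonneg (3 * c * S + 1)
  rw [gramExp_comm φ (r * _, _), gramExp_comm φ (r' * _, _)] at F2
  simp only [← sub_mul, abs_mul, ← mul_add] at F1 F2
  have G1 : |s - s'| * (|Real.cos α| + |-Real.sin α|) ≤ |s - s'| * 2 := by gcongr; linarith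
  have G2 : |r - r'| * (|Real.cos δ| + |Real.sin δ|) ≤ |r - r'| * 2 := by gcongr; linarith
  have F1' := F1.trans (show _ ≤ C ^ 2 * (|s - s'| * 2) * expMoment (3 * c * S + 1) by gcongr)
  have F2' := F2.trans (show _ ≤ C ^ 2 * (|r - r'| * 2) * expMoment (3 * c * S + 1) by gcongr)
  have e : |2 * (s' * Real.sin α * (r' * Real.sin δ))| =
      2 * |s' * -Real.sin α * (r' * Real.sin δ)| := by
    rw [abs_mul, abs_two, ← abs_neg]; congr 2; ring
  rw [e]
  have t1 := abs_sub_le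
    (gramExp φ (s * Real.cos α, s * -Real.sin α) (r * Real.cos δ, r * Real.sin δ))
    (gramExp φ (s' * Real.cos α, s' * -Real.sin α) (r * Real.cos δ, r * Real.sin δ))
    (gramExp φ (s' * Real.cos α, s' * -Real.sin α) (r' * Real.cos δ, -(r' * Real.sin δ)))
  have t2 := abs_sub_le
    (gramExp φ (s' * Real.cos α, s' * -Real.sin α) (r * Real.cos δ, r * Real.sin δ))
    (gramExp φ (s' * Real.cos α, s' * -Real.sin α) (r' * Real.cos δ, r' * Real.sin δ))
    (gramExp φ (s' * Real.cos α, s' * -Real.sin α) (r' * Real.cos δ, -(r' * Real.sin δ)))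
  simp only at F3
  linarith

theorem abs_sqrt_sub_sqrt_le {S x y : ℝ} (hS : 0 < S) (hx : 1 / S ≤ √x) (hy : 1 / S ≤ √y) :
    |√x - √y| ≤ S * |x - y| := by
  have hp : 0 < 1 / S := by positivity
  have hx0 := Real.sqrt_pos.1 (hp.trans_le hx)
  have hy0 := Real.sqrt_pos.1 (hp.trans_le hy)
  have : x - y = (√x - √y) * (√x + √y) := by
    nlinarith [Real.sq_sqrt hx0.le, Real.sq_sqrt hy0.le]
  rw [this, abs_mul, abs_of_pos (show 0 < √x + √y by linarith)]
  have h3 : 1 ≤ S * (√x + √y) := by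
    have : S * (1 / S) = 1 := by field_simp
    nlinarith
  nlinarith [abs_nonneg (√x - √y)]

theorem exists_mul_cos_eq {s r b : ℝ} (hs : 0 < s) (hr : 0 < r) (hb : b ^ 2 ≤ s ^ 2 * r ^ 2) :
    ∃ θ : ℝ, s * r * Real.cos θ = b := by
  have h1 : |b| ≤ s * r := abs_le_of_sq_le_sq (by rw [mul_pow]; exact hb) (by positivity)
  have h2 : |b / (s * r)| ≤ 1 := by
    rw [abs_div, abs_of_pos (mul_pos hs hr)]
    exact (div_le_one (mul_pos hs hr)).2 h1
  refine ⟨Real.arccos (b / (s * r)), ?_⟩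
  rw [Real.cos_arccos (abs_le.1 h2).1 (abs_le.1 h2).2]
  field_simp

/-- `V_φ` is Lipschitz on `PSD_2(R)`, up to the boundary of the cone. -/
theorem ExpLipschitz.exists_V_lipschitz (hφ : ExpLipschitz φ C c) {R : ℝ} (hR : 0 < R) :
    ∃ L, 0 ≤ L ∧ ∀ a b e a' b' e' : ℝ, cov2 a b e ∈ PSD2 R → cov2 a' b' e' ∈ PSD2 R →
      |V φ (cov2 a b e) - V φ (cov2 a' b' e')| ≤ L * (|a - a'| + |b - b'| + |e - e'|) := by
  obtain ⟨S, hS, hSR⟩ : ∃ S, 0 < S ∧ S = √R := ⟨_, Real.sqrt_pos.2 hR, rfl⟩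
  have hJ1 := expMoment_nonneg (3 * c * S + 1)
  have hJ2 := expMoment_nonneg (4 * c * S + 1)
  have hC := hφ.C_nonneg
  refine ⟨2 * C ^ 2 * expMoment (3 * c * S + 1) * S +
    2 * C ^ 2 * expMoment (4 * c * S + 1) * (1 + S ^ 2), by positivity, ?_⟩
  intro a b e a' b' e' h h'
  have hm := hφ.continuous.measurable
  have bounds : ∀ {x : ℝ}, 1 / R ≤ x → x ≤ R →
      ∃ s, s = √x ∧ 0 < s ∧ s ^ 2 = x ∧ 1 / S ≤ √x ∧ s ≤ S := by
    intro x h1 h2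
    have hx : 0 < x := lt_of_lt_of_le (by positivity) h1
    refine ⟨√x, rfl, Real.sqrt_pos.2 hx, Real.sq_sqrt hx.le, ?_, hSR ▸ Real.sqrt_le_sqrt h2⟩
    have := Real.sqrt_le_sqrt h1
    rwa [Real.sqrt_div zero_le_one, Real.sqrt_one, ← hSR] at this
  obtain ⟨h0, hd⟩ := h
  obtain ⟨h0', hd'⟩ := h'
  obtain ⟨-, -, hb⟩ := cov2_posSemidef_iff.1 h0
  obtain ⟨-, -, hb'⟩ := cov2_posSemidef_iff.1 h0'
  obtain ⟨s, es, s0, sa, la, ua⟩ := bounds (x := a) (hd 0).1 (hd 0).2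
  obtain ⟨r, er, r0, re, le, ue⟩ := bounds (x := e) (hd 1).1 (hd 1).2
  obtain ⟨s', es', s0', sa', la', ua'⟩ := bounds (x := a') (hd' 0).1 (hd' 0).2
  obtain ⟨r', er', r0', re', le', ue'⟩ := bounds (x := e') (hd' 1).1 (hd' 1).2
  have d1 := abs_sqrt_sub_sqrt_le hS la la'
  have d2 := abs_sqrt_sub_sqrt_le hS le le'
  rw [← es, ← es'] at d1
  rw [← er, ← er'] at d2
  obtain ⟨θ, hθ⟩ := exists_mul_cos_eq (b := b) s0 r0 (by rw [sa, re]; exact hb)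
  obtain ⟨θ', hθ'⟩ := exists_mul_cos_eq (b := b') s0' r0' (by rw [sa', re']; exact hb')
  obtain ⟨α, δ, eθ, eθ'⟩ : ∃ α δ : ℝ, θ = α + δ ∧ θ' = α - δ :=
    ⟨(θ + θ') / 2, (θ - θ') / 2, by ring, by ring⟩
  have cα := Real.cos_sq_add_sin_sq α
  have cδ := Real.cos_sq_add_sin_sq δ
  have E1 : V φ (cov2 a b e) =
      gramExp φ (s * Real.cos α, s * -Real.sin α) (r * Real.cos δ, r * Real.sin δ) := by
    refine V_gram_eq hm ?_ ?_ ?_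
    · rw [← sa]; linear_combination s ^ 2 * cα
    · rw [← hθ, eθ, Real.cos_add]; ring
    · rw [← re]; linear_combination r ^ 2 * cδ
  have E2 : V φ (cov2 a' b' e') =
      gramExp φ (s' * Real.cos α, s' * -Real.sin α) (r' * Real.cos δ, -(r' * Real.sin δ)) := by
    refine V_gram_eq hm ?_ ?_ ?_
    · rw [← sa']; linear_combination s' ^ 2 * cα
    · rw [← hθ', eθ', Real.cos_sub]; ring
    · rw [← re']; linear_combination r' ^ 2 * cδ
  have F := hφ.abs_gramExp_polar_sub_le (S := S) α δ (by rwa [abs_of_pos s0])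
    (by rwa [abs_of_pos r0]) (by rwa [abs_of_pos s0']) (by rwa [abs_of_pos r0'])
  rw [← E1, ← E2] at F
  -- only the product `s' r' (ρ - ρ')` enters, so no correlation has to be compared by itself
  have G : |2 * (s' * Real.sin α * (r' * Real.sin δ))| ≤
      |b - b'| + S ^ 2 * |a - a'| + S ^ 2 * |e - e'| := by
    have h1 : 2 * (s' * Real.sin α * (r' * Real.sin δ)) =
        (b' - b) + (s' * (r - r') + r * (s - s')) * Real.cos θ := by
      rw [← hθ, ← hθ', eθ, eθ', Real.cos_add, Real.cos_sub]; ring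
    have h2 : |s' * (r - r') + r * (s - s')| ≤ S ^ 2 * |a - a'| + S ^ 2 * |e - e'| := by
      refine (abs_add_le _ _).trans ?_
      rw [abs_mul, abs_mul, abs_of_pos s0', abs_of_pos r0]
      have h3 : s' * |r - r'| ≤ S * (S * |e - e'|) := by gcongr
      have h4 : r * |s - s'| ≤ S * (S * |a - a'|) := by gcongr
      linarith
    rw [h1]
    refine (abs_add_le _ _).trans ?_
    rw [abs_mul, abs_sub_comm b']
    have := mul_le_of_le_one_right (abs_nonneg (s' * (r - r') + r * (s - s')))
      (Real.abs_cos_le_one θ)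
    linarith
  refine F.trans ?_
  rw [add_mul]
  have u1 : |s - s'| + |r - r'| ≤ S * (|a - a'| + |b - b'| + |e - e'|) := by
    linarith [mul_nonneg hS.le (abs_nonneg (b - b'))]
  have u2 : |2 * (s' * Real.sin α * (r' * Real.sin δ))| ≤
      (1 + S ^ 2) * (|a - a'| + |b - b'| + |e - e'|) := by
    linarith [abs_nonneg (a - a'), abs_nonneg (e - e'),
      mul_nonneg (sq_nonneg S) (abs_nonneg (b - b'))]
  rw [mul_assoc _ S, mul_assoc _ (1 + S ^ 2)]
  gcongr

end Kernel

/-! ### Grönwall's inequality and means of square integrable functions -/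

theorem abs_exp_sub_exp_le {B x y : ℝ} (hx : x ≤ B) (hy : y ≤ B) :
    |Real.exp x - Real.exp y| ≤ Real.exp B * |x - y| := by
  have := (convex_Iic B).norm_image_sub_le_of_norm_deriv_le (f := Real.exp) (C := Real.exp B)
    (fun z _ => Real.differentiableAt_exp) (fun z hz => by
      rw [Real.deriv_exp, Real.norm_eq_abs, abs_of_pos (Real.exp_pos _)]
      exact Real.exp_le_exp.2 hz) hy hx
  simpa using this

theorem absolutelyContinuousOnInterval_exp {f : ℝ → ℝ} {a b : ℝ}
    (hf : AbsolutelyContinuousOnInterval f a b) :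
    AbsolutelyContinuousOnInterval (fun t => Real.exp (f t)) a b := by
  obtain ⟨B, hB⟩ := hf.exists_bound
  have hB' : ∀ x ∈ uIcc a b, f x ≤ B := fun x hx => (le_abs_self _).trans (hB x hx)
  have h0 := Tendsto.const_mul (Real.exp B) hf
  rw [mul_zero] at h0
  refine squeeze_zero' (Eventually.of_forall fun E => Finset.sum_nonneg fun _ _ => dist_nonneg)
    ?_ h0
  filter_upwards [mem_inf_of_right (mem_principal_self _)] with E hE
  rw [Finset.mul_sum]
  refine Finset.sum_le_sum fun i hi => ?_
  have := hE.1 i hi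
  exact abs_exp_sub_exp_le (hB' _ this.1) (hB' _ this.2)

/-- Grönwall's inequality with an integrable weight: maximise `E t * exp (-2 L W t)`, where `W` is
the primitive of the weight, over `[0,1]`. -/
theorem gronwall_integrable_weight {E w : ℝ → ℝ} {η L : ℝ} (hE : ContinuousOn E (Icc 0 1))
    (hw : IntervalIntegrable w volume 0 1) (hw0 : ∀ s, 0 ≤ w s) (hL : 0 ≤ L)
    (h : ∀ t ∈ Icc (0 : ℝ) 1, E t ≤ η + L * ∫ s in (0 : ℝ)..t, w s * E s) (hη : 0 ≤ η) :
    ∀ t ∈ Icc (0 : ℝ) 1, E t ≤ 2 * η * Real.exp (2 * L * ∫ s in (0 : ℝ)..1, w s) := by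
  set W : ℝ → ℝ := fun t => ∫ s in (0 : ℝ)..t, w s with hWdef
  have sub : ∀ {t}, t ∈ Icc (0 : ℝ) 1 → uIcc 0 t ⊆ uIcc (0 : ℝ) 1 := by
    intro t ht
    rw [uIcc_of_le ht.1, uIcc_of_le zero_le_one]
    exact Icc_subset_Icc_right ht.2
  have hWac : AbsolutelyContinuousOnInterval W 0 1 :=
    hw.absolutelyContinuousOnInterval_intervalIntegral (by simp)
  have hFac : AbsolutelyContinuousOnInterval (fun t => Real.exp (2 * L * W t)) 0 1 :=
    absolutelyContinuousOnInterval_exp (hWac.const_mul _)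
  have hWc : ContinuousOn W (Icc 0 1) := by
    have := hWac.continuousOn
    rwa [uIcc_of_le zero_le_one] at this
  have hFc : ContinuousOn (fun t => Real.exp (2 * L * W t)) (Icc 0 1) := by fun_prop
  have hFi : ∀ t ∈ Icc (0 : ℝ) 1,
      2 * L * ∫ s in (0 : ℝ)..t, w s * Real.exp (2 * L * W s) = Real.exp (2 * L * W t) - 1 := by
    intro t ht
    have h1 := (hFac.mono (sub ht)).integral_deriv_eq_sub
    have h2 : W 0 = 0 := by simp [hWdef]
    simp only [h2, mul_zero, Real.exp_zero] at h1
    rw [← h1, ← intervalIntegral.integral_const_mul]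
    refine intervalIntegral.integral_congr_ae ?_
    filter_upwards [hw.ae_hasDerivAt_integral] with s hs hsm
    have hs' := hs (sub ht (uIoc_subset_uIcc hsm)) 0 (by simp)
    have := ((hs'.const_mul (2 * L)).exp).deriv
    rw [this]
    ring
  obtain ⟨t₀, ht₀, hmax⟩ := isCompact_Icc.exists_isMaxOn (nonempty_Icc.2 zero_le_one)
    (f := fun t => E t * Real.exp (-(2 * L * W t))) (by fun_prop)
  set m := E t₀ * Real.exp (-(2 * L * W t₀)) with hm
  have hEm : ∀ t ∈ Icc (0 : ℝ) 1, E t ≤ m * Real.exp (2 * L * W t) := by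
    intro t ht
    have h1 : E t * Real.exp (-(2 * L * W t)) ≤ m := hmax ht
    have h2 := mul_le_mul_of_nonneg_right h1 (Real.exp_pos (2 * L * W t)).le
    rwa [mul_assoc, ← Real.exp_add, neg_add_cancel, Real.exp_zero, mul_one] at h2
  have wi : ∀ {g : ℝ → ℝ}, ContinuousOn g (Icc 0 1) →
      IntervalIntegrable (fun s => w s * g s) volume 0 t₀ := by
    intro g hg
    refine (hw.mono_set (sub ht₀)).mul_continuousOn (hg.mono ?_)
    rw [← uIcc_of_le zero_le_one]
    exact sub ht₀
  -- at the maximum the integral absorbs only half of the exponential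
  have hmη : m ≤ 2 * η := by
    have h1 := h t₀ ht₀
    have h2 : ∫ s in (0 : ℝ)..t₀, w s * E s ≤
        ∫ s in (0 : ℝ)..t₀, m * (w s * Real.exp (2 * L * W s)) := by
      refine intervalIntegral.integral_mono_on ht₀.1 (wi hE) ((wi hFc).const_mul m) fun s hs => ?_
      have := mul_le_mul_of_nonneg_left (hEm s ⟨hs.1, hs.2.trans ht₀.2⟩) (hw0 s)
      linarith
    rw [intervalIntegral.integral_const_mul] at h2
    have h3 := hFi t₀ ht₀
    have h4 : E t₀ = m * Real.exp (2 * L * W t₀) := by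
      rw [hm, mul_assoc, ← Real.exp_add, neg_add_cancel, Real.exp_zero, mul_one]
    have h5 : L * ∫ s in (0 : ℝ)..t₀, w s * E s ≤ m * (Real.exp (2 * L * W t₀) - 1) / 2 := by
      rw [← h3]
      refine (mul_le_mul_of_nonneg_left h2 hL).trans (le_of_eq ?_)
      ring
    have hW0 : 0 ≤ W t₀ := intervalIntegral.integral_nonneg ht₀.1 fun s _ => hw0 s
    have h6 : 1 ≤ Real.exp (2 * L * W t₀) := Real.one_le_exp (by positivity)
    rw [h4] at h1
    by_contra hcon
    push Not at hcon
    have h7 : m * (Real.exp (2 * L * W t₀) + 1) ≤ 2 * η := by linarith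
    nlinarith
  intro t ht
  refine (hEm t ht).trans ?_
  have h1 : W t ≤ W 1 := by
    have h2 : W 1 - W t = ∫ s in t..1, w s := by
      simp only [hWdef]
      rw [sub_eq_iff_eq_add, add_comm, intervalIntegral.integral_add_adjacent_intervals
        (hw.mono_set (sub ht)) (hw.mono_set ?_)]
      rw [uIcc_of_le ht.2, uIcc_of_le zero_le_one]
      exact Icc_subset_Icc_left ht.1
    have : 0 ≤ ∫ s in t..1, w s := intervalIntegral.integral_nonneg ht.2 fun s _ => hw0 s
    linarith
  change _ ≤ 2 * η * Real.exp (2 * L * W 1)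
  gcongr

section Chord

variable {F : Type*} [NormedAddCommGroup F] [InnerProductSpace ℝ F]

theorem integrable_inner_of_memLp_two {α : Type*} {mα : MeasurableSpace α} {μ : Measure α}
    {f g : α → F} (hf : MemLp f 2 μ) (hg : MemLp g 2 μ) :
    Integrable (fun s => inner ℝ (f s) (g s)) μ := by
  refine ((hf.integrable_norm_pow two_ne_zero).add (hg.integrable_norm_pow two_ne_zero)).mono'
    (hf.1.inner hg.1) (Eventually.of_forall fun s => ?_)
  refine (abs_real_inner_le_norm _ _).trans ?_
  simp only [Pi.add_apply]
  nlinarith [sq_nonneg (‖f s‖ - ‖g s‖), sq_nonneg (‖f s‖ + ‖g s‖)]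

/-- A square integrable function on `[0,1]` is, on short intervals, close in `L²` to constants;
the errors are controlled by an additive quantity of small total size. -/
theorem exists_local_const_approx {f : ℝ → F} (hf : MemLp f 2 (volume.restrict (Icc (0 : ℝ) 1)))
    {ε : ℝ} (hε : 0 < ε) :
    ∃ δ > 0, ∃ h : ℝ → ℝ, IntervalIntegrable h volume 0 1 ∧ (∀ s, 0 ≤ h s) ∧
      ∫ s in (0 : ℝ)..1, h s ≤ ε ∧ ∀ u t, 0 ≤ u → u ≤ t → t ≤ 1 → t - u < δ →
        ∃ a : F, ∫ s in u..t, ‖f s - a‖ ^ 2 ≤ ∫ s in u..t, h s := by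
  have hf2 : MemLp f (ENNReal.ofReal 2) (volume.restrict (Icc (0 : ℝ) 1)) := by simpa using hf
  obtain ⟨g, hg, hgm⟩ := hf2.exists_boundedContinuous_integral_rpow_sub_le two_pos
    (show 0 < ε / 4 by positivity)
  rw [show ENNReal.ofReal 2 = 2 by simp] at hgm
  simp only [Real.rpow_ofNat] at hg
  have huc := isCompact_Icc.uniformContinuousOn_of_continuous
    (g.continuous.continuousOn (s := Icc (0 : ℝ) 1))
  rw [Metric.uniformContinuousOn_iff] at huc
  obtain ⟨δ, hδ, hgδ⟩ := huc (√(ε / 4)) (Real.sqrt_pos.2 (by positivity))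
  have hi : IntegrableOn (fun s => ‖f s - g s‖ ^ 2) (Icc (0 : ℝ) 1) :=
    (hf.sub hgm).integrable_norm_pow two_ne_zero
  have hi' : IntervalIntegrable (fun s => ‖f s - g s‖ ^ 2) volume 0 1 :=
    (intervalIntegrable_iff_integrableOn_Icc_of_le zero_le_one).2 hi
  have hh : IntervalIntegrable (fun s => 2 * ‖f s - g s‖ ^ 2 + ε / 2) volume 0 1 :=
    (hi'.const_mul 2).add intervalIntegrable_const
  refine ⟨δ, hδ, fun s => 2 * ‖f s - g s‖ ^ 2 + ε / 2, hh, fun s => by positivity, ?_, ?_⟩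
  · rw [intervalIntegral.integral_add (hi'.const_mul 2) intervalIntegrable_const,
      intervalIntegral.integral_const_mul, intervalIntegral.integral_of_le zero_le_one,
      ← integral_Icc_eq_integral_Ioc]
    simp
    linarith
  · intro u t hu hut ht htu
    have sub : Ioc u t ⊆ Icc 0 1 := fun s hs => ⟨hu.trans hs.1.le, hs.2.trans ht⟩
    have sub' : uIcc u t ⊆ uIcc 0 1 := by
      rw [uIcc_of_le hut, uIcc_of_le zero_le_one]; exact Icc_subset_Icc hu ht
    refine ⟨g u, intervalIntegral.integral_mono_on hut ?_ (hh.mono_set sub') fun s hs => ?_⟩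
    · rw [intervalIntegrable_iff_integrableOn_Ioc_of_le hut]
      exact ((hf.mono_measure (Measure.restrict_mono sub le_rfl)).sub
        (memLp_const (g u))).integrable_norm_pow two_ne_zero
    · have h1 : ‖g s - g u‖ < √(ε / 4) := by
        rw [← dist_eq_norm]
        refine hgδ s ⟨hu.trans hs.1, hs.2.trans ht⟩ u ⟨hu, hut.trans ht⟩ ?_
        rw [Real.dist_eq, abs_of_nonneg (by linarith [hs.1])]
        linarith [hs.2]
      have h2 : ‖g s - g u‖ ^ 2 ≤ ε / 4 := by
        rw [← Real.sq_sqrt (show 0 ≤ ε / 4 by positivity)]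
        gcongr
      have h3 : ‖f s - g u‖ ≤ ‖f s - g s‖ + ‖g s - g u‖ := norm_sub_le_norm_sub_add_norm_sub _ _ _
      have h4 : ‖f s - g u‖ ^ 2 ≤ (‖f s - g s‖ + ‖g s - g u‖) ^ 2 := by gcongr
      nlinarith [sq_nonneg (‖f s - g s‖ - ‖g s - g u‖)]

variable [CompleteSpace F]

theorem integral_inner_sub_const {f g : ℝ → F} {u t : ℝ} (hut : u ≤ t)
    (hf : MemLp f 2 (volume.restrict (Ioc u t))) (hg : MemLp g 2 (volume.restrict (Ioc u t)))
    (a b : F) :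
    ∫ s in u..t, inner ℝ (f s - a) (g s - b) =
      (∫ s in u..t, inner ℝ (f s) (g s)) - inner ℝ (∫ s in u..t, f s) b
        - inner ℝ a (∫ s in u..t, g s) + (t - u) * inner ℝ a b := by
  have hfi : Integrable f (volume.restrict (Ioc u t)) := hf.integrable (by norm_num)
  have hgi : Integrable g (volume.restrict (Ioc u t)) := hg.integrable (by norm_num)
  have ii := integrable_inner_of_memLp_two hf hg
  have e : ∀ s, inner ℝ (f s - a) (g s - b) =
      inner ℝ (f s) (g s) - inner ℝ b (f s) - inner ℝ a (g s) + inner ℝ a b := by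
    intro s
    rw [inner_sub_left, inner_sub_right, inner_sub_right, real_inner_comm b]; ring
  simp only [intervalIntegral.integral_of_le hut, e]
  have i1 := hfi.const_inner (𝕜 := ℝ) b
  have i2 := hgi.const_inner (𝕜 := ℝ) a
  have e1 := integral_add ((ii.sub i1).sub i2) (integrable_const (inner ℝ a b))
  have e2 := integral_sub (ii.sub i1) i2
  simp only [Pi.sub_apply] at e1 e2
  rw [e1, e2, integral_sub ii i1, integral_inner hfi, integral_inner hgi,
    real_inner_comm b (∫ s in Ioc u t, f s)]
  simp [hut]

/-- The best constant approximation of `f` in `L²` is its mean. -/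
theorem integral_norm_sub_mean_sq_le {f : ℝ → F} {u t : ℝ} (hut : u < t)
    (hf : MemLp f 2 (volume.restrict (Ioc u t))) (a : F) :
    ∫ s in u..t, ‖f s - (t - u)⁻¹ • ∫ r in u..t, f r‖ ^ 2 ≤ ∫ s in u..t, ‖f s - a‖ ^ 2 := by
  have h0 : 0 < t - u := sub_pos.2 hut
  simp only [← real_inner_self_eq_norm_sq]
  rw [integral_inner_sub_const hut.le hf hf, integral_inner_sub_const hut.le hf hf]
  set I := ∫ r in u..t, f r
  have h1 : 0 ≤ (t - u) * inner ℝ (a - (t - u)⁻¹ • I) (a - (t - u)⁻¹ • I) :=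
    mul_nonneg h0.le real_inner_self_nonneg
  rw [inner_sub_left, inner_sub_right, inner_sub_right] at h1
  simp only [real_inner_smul_left, real_inner_smul_right] at h1 ⊢
  rw [real_inner_comm a I] at *
  have h2 : (t - u) * (t - u)⁻¹ = 1 := mul_inv_cancel₀ h0.ne'
  have h3 : (t - u) * ((t - u)⁻¹ * ((t - u)⁻¹ * inner ℝ I I)) = (t - u)⁻¹ * inner ℝ I I := by
    rw [← mul_assoc, h2, one_mul]
  have h4 : (t - u) * ((t - u)⁻¹ * inner ℝ a I) = inner ℝ a I := by
    rw [← mul_assoc, h2, one_mul]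
  nlinarith

/-- Replacing two square integrable functions by their means changes the integral of their scalar
product by at most their `L²` distances to constants. -/
theorem abs_chord_sub_integral_inner_le {f g : ℝ → F} {u t : ℝ} (hut : u < t)
    (hf : MemLp f 2 (volume.restrict (Ioc u t))) (hg : MemLp g 2 (volume.restrict (Ioc u t)))
    (a b : F) :
    |inner ℝ (∫ s in u..t, f s) (∫ s in u..t, g s) / (t - u) - ∫ s in u..t, inner ℝ (f s) (g s)| ≤
      (∫ s in u..t, ‖f s - a‖ ^ 2) + ∫ s in u..t, ‖g s - b‖ ^ 2 := by
  have h0 : 0 < t - u := sub_pos.2 hut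
  set I := ∫ r in u..t, f r
  set J := ∫ r in u..t, g r
  have h1 := integral_inner_sub_const hut.le hf hg ((t - u)⁻¹ • I) ((t - u)⁻¹ • J)
  have e : inner ℝ I J / (t - u) - ∫ s in u..t, inner ℝ (f s) (g s) =
      - ∫ s in u..t, inner ℝ (f s - (t - u)⁻¹ • I) (g s - (t - u)⁻¹ • J) := by
    rw [h1]
    simp only [real_inner_smul_left, real_inner_smul_right]
    field_simp
    ring
  have hf' := hf.sub (memLp_const ((t - u)⁻¹ • I))
  have hg' := hg.sub (memLp_const ((t - u)⁻¹ • J))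
  have if' := hf'.integrable_norm_pow two_ne_zero
  have ig' := hg'.integrable_norm_pow two_ne_zero
  rw [e, abs_neg]
  refine le_trans ?_ (add_le_add (integral_norm_sub_mean_sq_le hut hf a)
    (integral_norm_sub_mean_sq_le hut hg b))
  change _ ≤ (∫ s in u..t, ‖f s - (t - u)⁻¹ • I‖ ^ 2) + ∫ s in u..t, ‖g s - (t - u)⁻¹ • J‖ ^ 2
  simp only [Pi.sub_apply] at if' ig'
  simp only [intervalIntegral.integral_of_le hut.le]
  rw [← integral_add if' ig', ← Real.norm_eq_abs]
  refine norm_integral_le_of_norm_le (if'.add ig') (Eventually.of_forall fun s => ?_)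
  refine (abs_real_inner_le_norm _ _).trans ?_
  nlinarith [sq_nonneg (‖f s - (t - u)⁻¹ • I‖ - ‖g s - (t - u)⁻¹ • J‖),
    sq_nonneg (‖f s - (t - u)⁻¹ • I‖ + ‖g s - (t - u)⁻¹ • J‖)]

/-- The Cauchy–Schwarz inequality, read off from the nonnegativity of the variance. -/
theorem norm_integral_sq_le {f : ℝ → F} {u t : ℝ} (hut : u ≤ t)
    (hf : MemLp f 2 (volume.restrict (Ioc u t))) :
    ‖∫ s in u..t, f s‖ ^ 2 ≤ (t - u) * ∫ s in u..t, ‖f s‖ ^ 2 := by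
  rcases hut.eq_or_lt with rfl | hut
  · simp
  have h0 : 0 < t - u := sub_pos.2 hut
  have h1 : 0 ≤ ∫ s in u..t, ‖f s - (t - u)⁻¹ • ∫ r in u..t, f r‖ ^ 2 :=
    intervalIntegral.integral_nonneg hut.le fun s _ => sq_nonneg _
  simp only [← real_inner_self_eq_norm_sq] at h1 ⊢
  rw [integral_inner_sub_const hut.le hf hf] at h1
  simp only [real_inner_smul_left, real_inner_smul_right] at h1
  set I := ∫ r in u..t, f r
  have h2 : (t - u) * (t - u)⁻¹ = 1 := mul_inv_cancel₀ h0.ne'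
  have h3 : (t - u) * ((t - u)⁻¹ * ((t - u)⁻¹ * inner ℝ I I)) = (t - u)⁻¹ * inner ℝ I I := by
    rw [← mul_assoc, h2, one_mul]
  rw [h3] at h1
  have h4 := mul_nonneg h0.le h1
  have h5 : (t - u) * ((t - u)⁻¹ * inner ℝ I I) = inner ℝ I I := by
    rw [← mul_assoc, h2, one_mul]
  nlinarith

theorem abs_inner_integral_le {f g : ℝ → F} {u t : ℝ} (hut : u ≤ t)
    (hf : MemLp f 2 (volume.restrict (Ioc u t))) (hg : MemLp g 2 (volume.restrict (Ioc u t))) :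
    |inner ℝ (∫ s in u..t, f s) (∫ s in u..t, g s) / (t - u)| ≤
      (∫ s in u..t, ‖f s‖ ^ 2) + ∫ s in u..t, ‖g s‖ ^ 2 := by
  rcases hut.eq_or_lt with rfl | hut'
  · simp
  have h0 : 0 < t - u := sub_pos.2 hut'
  rw [abs_div, abs_of_pos h0, div_le_iff₀ h0]
  have h1 := norm_integral_sq_le hut hf
  have h2 := norm_integral_sq_le hut hg
  refine (abs_real_inner_le_norm _ _).trans ?_
  nlinarith [sq_nonneg (‖∫ s in u..t, f s‖ - ‖∫ s in u..t, g s‖),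
    sq_nonneg (‖∫ s in u..t, f s‖ + ‖∫ s in u..t, g s‖)]

end Chord

/-! ### Partitions of the unit interval -/

namespace UnitPartition

variable (D : UnitPartition)

theorem pt_le_pt {i j : ℕ} (hij : i ≤ j) (hj : j ≤ D.n) : D.pt i ≤ D.pt j :=
  D.strictMonoOn.monotoneOn (mem_Iic.2 (hij.trans hj)) (mem_Iic.2 hj) hij

theorem pt_mem {m : ℕ} (hm : m ≤ D.n) : D.pt m ∈ Icc (0 : ℝ) 1 :=
  ⟨D.pt_zero ▸ D.pt_le_pt (Nat.zero_le m) hm, D.pt_last ▸ D.pt_le_pt hm le_rfl⟩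

theorem idx_of_mem_Ico {m : ℕ} (hm : m < D.n) {t : ℝ} (ht : t ∈ Ico (D.pt m) (D.pt (m + 1))) :
    D.idx t = m := by
  classical
  rw [idx, Nat.findGreatest_eq_iff]
  refine ⟨hm.le, fun _ => ht.1, fun k hk hkn => not_le.2 (ht.2.trans_le (D.pt_le_pt hk hkn))⟩

theorem idx_pt {m : ℕ} (hm : m ≤ D.n) : D.idx (D.pt m) = m := by
  classical
  rw [idx, Nat.findGreatest_eq_iff]
  exact ⟨hm, fun _ => le_rfl, fun k hk hkn => not_le.2
    (D.strictMonoOn (mem_Iic.2 hm) (mem_Iic.2 hkn) hk)⟩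

theorem sub_le_mesh {m : ℕ} (hm : m < D.n) : D.pt (m + 1) - D.pt m ≤ D.mesh :=
  le_ciSup (f := fun i : Fin D.n => D.pt ((i : ℕ) + 1) - D.pt (i : ℕ))
    (Set.finite_range _).bddAbove ⟨m, hm⟩

/-- Induction along the intervals of a partition. -/
theorem induction_on {P : ℝ → Prop} (h0 : P 0)
    (hs : ∀ m < D.n, P (D.pt m) → ∀ t ∈ Icc (D.pt m) (D.pt (m + 1)), P t) :
    ∀ t ∈ Icc (0 : ℝ) 1, P t := by
  have hp : ∀ m ≤ D.n, ∀ t ∈ Icc (0 : ℝ) (D.pt m), P t := by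
    intro m
    induction m with
    | zero =>
      intro _ t ht
      rw [D.pt_zero] at ht
      rwa [le_antisymm ht.2 ht.1]
    | succ m ih =>
      intro hm t ht
      rcases le_total t (D.pt m) with h | h
      · exact ih (Nat.le_of_succ_le hm) t ⟨ht.1, h⟩
      · exact hs m hm (ih (Nat.le_of_succ_le hm) _ ⟨(D.pt_mem (Nat.le_of_succ_le hm)).1, le_rfl⟩)
          t ⟨h, ht.2⟩
  intro t ht
  exact hp D.n le_rfl t (by rwa [D.pt_last])

/-- The partition of `[0,1]` into `M + 1` intervals of equal length. -/
noncomputable def uniform (M : ℕ) : UnitPartition where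
  n := M + 1
  pt i := i / (M + 1)
  pt_zero := by simp
  pt_last := by push_cast; exact div_self (by positivity)
  strictMonoOn := fun i _ j _ hij => by
    have : (i : ℝ) < j := by exact_mod_cast hij
    exact div_lt_div_of_pos_right this (by positivity)

theorem mesh_uniform (M : ℕ) : (uniform M).mesh = 1 / (M + 1) := by
  have : ∀ i : Fin (uniform M).n, (uniform M).pt ((i : ℕ) + 1) - (uniform M).pt (i : ℕ) =
      1 / (M + 1) := by
    intro i
    simp only [uniform]
    push_cast
    ring
  have : Nonempty (Fin (uniform M).n) := ⟨⟨0, Nat.succ_pos M⟩⟩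
  exact (congrArg iSup (funext ‹∀ i : Fin (uniform M).n, _›)).trans ciSup_const

end UnitPartition

/-! ### Paths with square integrable derivative -/

variable {d : ℕ}

theorem uIcc_subset_unit {u t : ℝ} (hu : 0 ≤ u) (hut : u ≤ t) (ht : t ≤ 1) :
    uIcc u t ⊆ uIcc (0 : ℝ) 1 := by
  rw [uIcc_of_le hut, uIcc_of_le zero_le_one]
  exact Icc_subset_Icc hu ht

namespace PathSpace

theorem memLp_dot_Ioc (x : PathSpace d) {u t : ℝ} (hu : 0 ≤ u) (ht : t ≤ 1) :
    MemLp x.dot 2 (volume.restrict (Ioc u t)) := by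
  have h : Ioc u t ⊆ Icc 0 1 := fun _ hs => ⟨hu.trans hs.1.le, hs.2.trans ht⟩
  exact x.memLp_dot.mono_measure (Measure.restrict_mono h le_rfl)

theorem intervalIntegrable_dot (x : PathSpace d) : IntervalIntegrable x.dot volume 0 1 := by
  rw [intervalIntegrable_iff_integrableOn_Icc_of_le zero_le_one]
  exact x.memLp_dot.integrable (by norm_num)

theorem eval_sub (x : PathSpace d) {u t : ℝ} (hu : 0 ≤ u) (hut : u ≤ t) (ht : t ≤ 1) :
    x.eval t - x.eval u = ∫ s in u..t, x.dot s := by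
  rw [x.eval_eq_integral ⟨hu.trans hut, ht⟩, x.eval_eq_integral ⟨hu, hut.trans ht⟩,
    sub_eq_iff_eq_add, add_comm, intervalIntegral.integral_add_adjacent_intervals]
  · exact x.intervalIntegrable_dot.mono_set (uIcc_subset_unit le_rfl hu (hut.trans ht))
  · exact x.intervalIntegrable_dot.mono_set (uIcc_subset_unit hu hut ht)

theorem intervalIntegrable_inner (x y : PathSpace d) :
    IntervalIntegrable (fun s => inner ℝ (x.dot s) (y.dot s)) volume 0 1 := by
  rw [intervalIntegrable_iff_integrableOn_Icc_of_le zero_le_one]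
  exact integrable_inner_of_memLp_two x.memLp_dot y.memLp_dot

theorem continuous_eval (x : PathSpace d) : Continuous x.eval :=
  x.path.continuous.comp continuous_projIcc

/-- `‖ẋ‖² + ‖ẏ‖²`, which dominates the scalar product of the derivatives. -/
noncomputable def energy (x y : PathSpace d) (s : ℝ) : ℝ := ‖x.dot s‖ ^ 2 + ‖y.dot s‖ ^ 2

theorem energy_nonneg (x y : PathSpace d) (s : ℝ) : 0 ≤ energy x y s := by
  unfold energy; positivity

theorem abs_inner_dot_le (x y : PathSpace d) (s : ℝ) :
    |inner ℝ (x.dot s) (y.dot s)| ≤ energy x y s := by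
  refine (abs_real_inner_le_norm _ _).trans ?_
  unfold energy
  nlinarith [sq_nonneg (‖x.dot s‖ - ‖y.dot s‖), sq_nonneg (‖x.dot s‖ + ‖y.dot s‖)]

theorem intervalIntegrable_norm_sq (x : PathSpace d) :
    IntervalIntegrable (fun s => ‖x.dot s‖ ^ 2) volume 0 1 := by
  rw [intervalIntegrable_iff_integrableOn_Icc_of_le zero_le_one]
  exact x.memLp_dot.integrable_norm_pow two_ne_zero

theorem intervalIntegrable_energy (x y : PathSpace d) :
    IntervalIntegrable (energy x y) volume 0 1 :=
  x.intervalIntegrable_norm_sq.add y.intervalIntegrable_norm_sq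

/-- The increment `⟨x_t - x_u, y_t - y_u⟩ / (t - u)` that drives the discrete kernels
(with value `0` for `t = u`). -/
noncomputable def chord (x y : PathSpace d) (u t : ℝ) : ℝ :=
  inner ℝ (x.eval t - x.eval u) (y.eval t - y.eval u) / (t - u)

theorem chord_self (x y : PathSpace d) (u : ℝ) : chord x y u u = 0 := by simp [chord]

theorem chord_nonneg (x : PathSpace d) {u t : ℝ} (hut : u ≤ t) : 0 ≤ chord x x u t :=
  div_nonneg real_inner_self_nonneg (sub_nonneg.2 hut)

theorem chord_sq_le (x y : PathSpace d) (u t : ℝ) :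
    chord x y u t ^ 2 ≤ chord x x u t * chord y y u t := by
  simp only [chord]
  rw [div_pow, div_mul_div_comm, ← sq]
  gcongr
  have := real_inner_mul_inner_self_le (x.eval t - x.eval u) (y.eval t - y.eval u)
  rwa [← sq] at this

theorem abs_chord_le (x y : PathSpace d) {u t : ℝ} (hu : 0 ≤ u) (hut : u ≤ t) (ht : t ≤ 1) :
    |chord x y u t| ≤ ∫ s in u..t, energy x y s := by
  have h := abs_inner_integral_le hut (x.memLp_dot_Ioc hu ht) (y.memLp_dot_Ioc hu ht)
  rw [← x.eval_sub hu hut ht, ← y.eval_sub hu hut ht,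
    ← intervalIntegral.integral_add
      (x.intervalIntegrable_norm_sq.mono_set (uIcc_subset_unit hu hut ht))
      (y.intervalIntegrable_norm_sq.mono_set (uIcc_subset_unit hu hut ht))] at h
  exact h

theorem integral_sub_integral {f : ℝ → ℝ} (hf : IntervalIntegrable f volume 0 1) {u t : ℝ}
    (hu : 0 ≤ u) (hut : u ≤ t) (ht : t ≤ 1) :
    (∫ s in (0 : ℝ)..t, f s) - ∫ s in (0 : ℝ)..u, f s = ∫ s in u..t, f s := by
  rw [sub_eq_iff_eq_add, add_comm, intervalIntegral.integral_add_adjacent_intervals]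
  · exact hf.mono_set (uIcc_subset_unit le_rfl hu (hut.trans ht))
  · exact hf.mono_set (uIcc_subset_unit hu hut ht)

theorem continuousOn_primitive {f : ℝ → ℝ} (hf : IntervalIntegrable f volume 0 1) :
    ContinuousOn (fun t => ∫ s in (0 : ℝ)..t, f s) (Icc 0 1) := by
  have := (hf.absolutelyContinuousOnInterval_intervalIntegral (c := 0) (by simp)).continuousOn
  rwa [uIcc_of_le zero_le_one] at this

theorem exists_small_integral {f : ℝ → ℝ} (hf : IntervalIntegrable f volume 0 1) {ε : ℝ}
    (hε : 0 < ε) : ∃ δ > 0, ∀ u t, 0 ≤ u → u ≤ t → t ≤ 1 → t - u < δ →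
      |∫ s in u..t, f s| ≤ ε := by
  have h := isCompact_Icc.uniformContinuousOn_of_continuous (continuousOn_primitive hf)
  rw [Metric.uniformContinuousOn_iff] at h
  obtain ⟨δ, hδ, h⟩ := h ε hε
  refine ⟨δ, hδ, fun u t hu hut ht htu => ?_⟩
  have := h t ⟨hu.trans hut, ht⟩ u ⟨hu, hut.trans ht⟩
    (by rw [Real.dist_eq, abs_of_nonneg (by linarith)]; exact htu)
  rw [Real.dist_eq, integral_sub_integral hf hu hut ht] at this
  exact this.le

/-- At `t = u`, where the quotient degenerates to `0 / 0`, continuity comes from the energy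
bound. -/
theorem continuousOn_chord (x y : PathSpace d) {u v : ℝ} (hu : 0 ≤ u) (hv : v ≤ 1) :
    ContinuousOn (chord x y u) (Icc u v) := by
  intro t ht
  rcases ht.1.eq_or_lt with rfl | hlt
  · rw [ContinuousWithinAt, chord_self]
    have huu : u ∈ Icc (0 : ℝ) 1 := ⟨hu, ht.2.trans hv⟩
    have h1 : Tendsto (fun t => (∫ s in (0 : ℝ)..t, energy x y s) -
        ∫ s in (0 : ℝ)..u, energy x y s) (𝓝[Icc u v] u) (𝓝 0) := by
      have := ((continuousOn_primitive (intervalIntegrable_energy x y) u huu).mono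
        (Icc_subset_Icc hu hv)).sub_const (∫ s in (0 : ℝ)..u, energy x y s)
      simpa [ContinuousWithinAt] using this
    refine squeeze_zero_norm' ?_ h1
    filter_upwards [self_mem_nhdsWithin] with t ht
    rw [integral_sub_integral (intervalIntegrable_energy x y) hu ht.1 (ht.2.trans hv)]
    exact abs_chord_le x y hu ht.1 (ht.2.trans hv)
  · have hx := x.continuous_eval
    have hy := y.continuous_eval
    refine ContinuousAt.continuousWithinAt ?_
    unfold chord
    exact ContinuousAt.div (by fun_prop) (by fun_prop) (sub_ne_zero.2 hlt.ne')

end PathSpace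

/-! ### The discrete kernels -/

open PathSpace

section Discrete

variable (φ : ℝ → ℝ) (σa σA σb : ℝ) (D : UnitPartition)

theorem interpKernel_pt (x y : PathSpace d) {m : ℕ} (hm : m ≤ D.n) :
    interpKernel φ σa σA σb D x y (D.pt m) = discreteKernel φ σa σA σb D m x y := by
  simp [interpKernel, D.idx_pt hm]

theorem interpKernel_zero (x y : PathSpace d) : interpKernel φ σa σA σb D x y 0 = σa ^ 2 := by
  rw [← D.pt_zero, interpKernel_pt φ σa σA σb D x y (Nat.zero_le _), discreteKernel]

/-- The recursion of the interpolated kernel, valid on the closed interval: at the right end point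
the interpolation formula of the next interval takes over, with the same value. -/
theorem interpKernel_step (x y : PathSpace d) {m : ℕ} (hm : m < D.n) {t : ℝ}
    (ht : t ∈ Icc (D.pt m) (D.pt (m + 1))) :
    interpKernel φ σa σA σb D x y t = interpKernel φ σa σA σb D x y (D.pt m) +
      (σA ^ 2 * V φ (cov2 (interpKernel φ σa σA σb D x x (D.pt m))
        (interpKernel φ σa σA σb D x y (D.pt m)) (interpKernel φ σa σA σb D y y (D.pt m)))
        + σb ^ 2) * chord x y (D.pt m) t := by
  simp only [interpKernel_pt φ σa σA σb D _ _ hm.le]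
  rcases ht.2.eq_or_lt with rfl | hlt
  · rw [interpKernel_pt φ σa σA σb D _ _ hm, discreteKernel, chord]
  · simp only [interpKernel, D.idx_of_mem_Ico hm ⟨ht.1, hlt⟩, chord, real_inner_smul_left,
      real_inner_smul_right]
    rcases eq_or_ne (t - D.pt m) 0 with h0 | h0
    · simp [h0]
    · field_simp

theorem continuousOn_interpKernel (x y : PathSpace d) :
    ContinuousOn (interpKernel φ σa σA σb D x y) (Icc 0 1) := by
  refine D.induction_on (P := fun t => ContinuousOn (interpKernel φ σa σA σb D x y) (Icc 0 t))
    (by simp) (fun m hm h t ht => ?_) 1 ⟨zero_le_one, le_rfl⟩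
  have h1 := D.pt_mem hm.le
  have h2 := D.pt_mem (Nat.succ_le_of_lt hm)
  rw [← Icc_union_Icc_eq_Icc h1.1 ht.1]
  refine h.union_of_isClosed ?_ isClosed_Icc isClosed_Icc
  have h3 : ContinuousOn (fun t => interpKernel φ σa σA σb D x y (D.pt m) +
      (σA ^ 2 * V φ (cov2 (interpKernel φ σa σA σb D x x (D.pt m))
        (interpKernel φ σa σA σb D x y (D.pt m)) (interpKernel φ σa σA σb D y y (D.pt m)))
        + σb ^ 2) * chord x y (D.pt m) t) (Icc (D.pt m) t) :=
    continuousOn_const.add (continuousOn_const.mul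
      (continuousOn_chord x y h1.1 (ht.2.trans h2.2)))
  exact h3.congr fun s hs => interpKernel_step φ σa σA σb D x y hm ⟨hs.1, hs.2.trans ht.2⟩

end Discrete

section Bounds

variable {φ : ℝ → ℝ} {C c : ℝ} (σa σA σb : ℝ)

/-- The sum of a positive semidefinite matrix and the Hadamard product of two others is
positive semidefinite. -/
theorem cov2_posSemidef_add_mul {a b c v w z p q r : ℝ} (h : (cov2 a b c).PosSemidef)
    (hv : 0 ≤ v) (hz : 0 ≤ z) (hw : w ^ 2 ≤ v * z) (hp : 0 ≤ p) (hr : 0 ≤ r)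
    (hq : q ^ 2 ≤ p * r) : (cov2 (a + v * p) (b + w * q) (c + z * r)).PosSemidef := by
  have add : ∀ {a b c a' b' c' : ℝ}, 0 ≤ a → 0 ≤ c → b ^ 2 ≤ a * c → 0 ≤ a' → 0 ≤ c' →
      b' ^ 2 ≤ a' * c' → (b + b') ^ 2 ≤ (a + a') * (c + c') := by
    intro a b c a' b' c' ha hc hb ha' hc' hb'
    have h1 : (2 * (b * b')) ^ 2 ≤ (a * c' + a' * c) ^ 2 := by
      have : b ^ 2 * b' ^ 2 ≤ a * c * (a' * c') := by gcongr
      nlinarith [sq_nonneg (a * c' - a' * c)]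
    have h2 := abs_le_of_sq_le_sq h1 (by positivity)
    have h3 := le_abs_self (2 * (b * b'))
    nlinarith
  obtain ⟨ha, hc, hb⟩ := cov2_posSemidef_iff.1 h
  refine cov2_posSemidef_iff.2 ⟨by positivity, by positivity,
    add ha hc hb (by positivity) (by positivity) ?_⟩
  have : w ^ 2 * q ^ 2 ≤ v * z * (p * r) := by gcongr
  nlinarith

/-- The coefficients `σ_A² V_φ + σ_b²` for the pairs `(x, x)`, `(x, y)`, `(y, y)` form a positive
semidefinite matrix. -/
theorem ExpLipschitz.coeff_sq_le (hφ : ExpLipschitz φ C c) {a b e : ℝ}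
    (h : (cov2 a b e).PosSemidef) :
    (σA ^ 2 * V φ (cov2 a b e) + σb ^ 2) ^ 2 ≤
      (σA ^ 2 * V φ (cov2 a a a) + σb ^ 2) * (σA ^ 2 * V φ (cov2 e e e) + σb ^ 2) := by
  obtain ⟨ha, he, -⟩ := cov2_posSemidef_iff.1 h
  have h1 : (cov2 (σb ^ 2) (σb ^ 2) (σb ^ 2)).PosSemidef :=
    cov2_posSemidef_iff.2 ⟨by positivity, by positivity, by nlinarith⟩
  have := cov2_posSemidef_add_mul h1 (hφ.V_self_nonneg ha) (hφ.V_self_nonneg he)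
    (hφ.V_sq_le h) (sq_nonneg σA) (sq_nonneg σA) (by nlinarith)
  have := (cov2_posSemidef_iff.1 this).2.2
  nlinarith

theorem interpKernel_posSemidef (hφ : ExpLipschitz φ C c) (D : UnitPartition)
    (x y : PathSpace d) {t : ℝ} (ht : t ∈ Icc (0 : ℝ) 1) :
    (cov2 (interpKernel φ σa σA σb D x x t) (interpKernel φ σa σA σb D x y t)
      (interpKernel φ σa σA σb D y y t)).PosSemidef := by
  refine D.induction_on (P := fun t => (cov2 (interpKernel φ σa σA σb D x x t)
    (interpKernel φ σa σA σb D x y t) (interpKernel φ σa σA σb D y y t)).PosSemidef)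
    ?_ (fun m hm h t ht => ?_) t ht
  · simp only [interpKernel_zero]
    exact cov2_posSemidef_iff.2 ⟨by positivity, by positivity, by nlinarith⟩
  · obtain ⟨ha, he, -⟩ := cov2_posSemidef_iff.1 h
    rw [interpKernel_step φ σa σA σb D x x hm ht, interpKernel_step φ σa σA σb D x y hm ht,
      interpKernel_step φ σa σA σb D y y hm ht]
    have ha' := hφ.V_self_nonneg ha
    have he' := hφ.V_self_nonneg he
    exact cov2_posSemidef_add_mul h (by positivity) (by positivity) (hφ.coeff_sq_le σA σb h)
      (chord_nonneg x ht.1) (chord_nonneg y ht.1) (chord_sq_le x y _ _)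

/-- The discrete Grönwall bound for the diagonal kernels: `V_φ` has linear growth on the diagonal,
and the increments are nonnegative and at most the integral of the energy. -/
theorem interpKernel_self_bounds (hφ : ExpLipschitz φ C c) {K : ℝ} (hK0 : 0 ≤ K)
    (hK : ∀ a, 0 ≤ a → V φ (cov2 a a a) ≤ K * (1 + a)) (D : UnitPartition) (x : PathSpace d)
    {t : ℝ} (ht : t ∈ Icc (0 : ℝ) 1) :
    σa ^ 2 ≤ interpKernel φ σa σA σb D x x t ∧
      1 + interpKernel φ σa σA σb D x x t ≤
        (1 + σa ^ 2) * Real.exp ((σA ^ 2 * K + σb ^ 2) * ∫ s in (0 : ℝ)..t, energy x x s) := by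
  refine D.induction_on (P := fun t => σa ^ 2 ≤ interpKernel φ σa σA σb D x x t ∧
      1 + interpKernel φ σa σA σb D x x t ≤
        (1 + σa ^ 2) * Real.exp ((σA ^ 2 * K + σb ^ 2) * ∫ s in (0 : ℝ)..t, energy x x s))
    ?_ (fun m hm h t ht => ?_) t ht
  · simp [interpKernel_zero]
  · rw [interpKernel_step φ σa σA σb D x x hm ht]
    set a := interpKernel φ σa σA σb D x x (D.pt m)
    obtain ⟨h1, h2⟩ := h
    have ha : 0 ≤ a := (sq_nonneg σa).trans h1
    have hV := hφ.V_self_nonneg ha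
    have hV' := hK a ha
    have hm0 := (D.pt_mem hm.le).1
    have hm1 := (D.pt_mem (Nat.succ_le_of_lt hm)).2
    have hc := chord_nonneg x ht.1
    have hc' := (le_abs_self _).trans (abs_chord_le x x hm0 ht.1 (ht.2.trans hm1))
    rw [← sub_add_cancel (∫ s in (0 : ℝ)..t, energy x x s) (∫ s in (0 : ℝ)..D.pt m, energy x x s),
      integral_sub_integral (intervalIntegrable_energy x x) hm0 ht.1 (ht.2.trans hm1)]
    set I := ∫ s in D.pt m..t, energy x x s
    set J := ∫ s in (0 : ℝ)..D.pt m, energy x x s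
    have hI : 0 ≤ I := hc.trans hc'
    set K' := σA ^ 2 * K + σb ^ 2
    have hK' : 0 ≤ K' := by positivity
    have hq : 0 ≤ σA ^ 2 * V φ (cov2 a a a) + σb ^ 2 := by positivity
    refine ⟨by linarith [mul_nonneg hq hc], ?_⟩
    have hco : σA ^ 2 * V φ (cov2 a a a) + σb ^ 2 ≤ K' * (1 + a) := by
      have := mul_le_mul_of_nonneg_left hV' (sq_nonneg σA)
      simp only [K']
      nlinarith [mul_nonneg (sq_nonneg σb) ha]
    calc 1 + (a + (σA ^ 2 * V φ (cov2 a a a) + σb ^ 2) * chord x x (D.pt m) t)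
        ≤ 1 + (a + (K' * (1 + a)) * I) := by gcongr
      _ = (1 + a) * (K' * I + 1) := by ring
      _ ≤ (1 + σa ^ 2) * Real.exp (K' * J) * Real.exp (K' * I) := by
          gcongr
          exact Real.add_one_le_exp _
      _ = _ := by rw [mul_assoc, ← Real.exp_add]; congr 2; ring

theorem exists_interpKernel_mem_PSD2 (hlin : LinearlyBounded φ) (hφ : ExpLipschitz φ C c)
    (hσa : 0 < σa) (x y : PathSpace d) :
    ∃ R, 0 < R ∧ ∀ D : UnitPartition, ∀ t ∈ Icc (0 : ℝ) 1,
      cov2 (interpKernel φ σa σA σb D x x t) (interpKernel φ σa σA σb D x y t)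
        (interpKernel φ σa σA σb D y y t) ∈ PSD2 R := by
  obtain ⟨K, hK0, hK⟩ := exists_V_self_le hlin hφ
  have key : ∀ x : PathSpace d, ∃ B, ∀ D : UnitPartition, ∀ t ∈ Icc (0 : ℝ) 1,
      interpKernel φ σa σA σb D x x t ≤ B := by
    intro x
    refine ⟨(1 + σa ^ 2) * Real.exp ((σA ^ 2 * K + σb ^ 2) * ∫ s in (0 : ℝ)..1, energy x x s),
      fun D t ht => ?_⟩
    have h := (interpKernel_self_bounds σa σA σb hφ hK0 hK D x ht).2
    have h1 : ∫ s in (0 : ℝ)..t, energy x x s ≤ ∫ s in (0 : ℝ)..1, energy x x s := by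
      rw [← sub_nonneg, integral_sub_integral (intervalIntegrable_energy x x) ht.1 ht.2 le_rfl]
      exact intervalIntegral.integral_nonneg ht.2 fun s _ => energy_nonneg x x s
    have h2 : (1 + σa ^ 2) *
        Real.exp ((σA ^ 2 * K + σb ^ 2) * ∫ s in (0 : ℝ)..t, energy x x s) ≤ (1 + σa ^ 2) *
        Real.exp ((σA ^ 2 * K + σb ^ 2) * ∫ s in (0 : ℝ)..1, energy x x s) := by gcongr
    linarith
  obtain ⟨B, hB⟩ := key x
  obtain ⟨B', hB'⟩ := key y
  have hs : 0 < σa ^ 2 := by positivity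
  refine ⟨max (1 / σa ^ 2) (max B B'), lt_max_of_lt_left (by positivity), fun D t ht =>
    ⟨interpKernel_posSemidef σa σA σb hφ D x y ht, ?_⟩⟩
  have hl : 1 / max (1 / σa ^ 2) (max B B') ≤ σa ^ 2 := by
    rw [one_div_le (lt_max_of_lt_left (by positivity)) hs]
    exact le_max_left _ _
  have h1 := (interpKernel_self_bounds σa σA σb hφ hK0 hK D x ht).1
  have h2 := (interpKernel_self_bounds σa σA σb hφ hK0 hK D y ht).1
  have h3 : B ≤ max (1 / σa ^ 2) (max B B') := (le_max_left _ _).trans (le_max_right _ _)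
  have h4 : B' ≤ max (1 / σa ^ 2) (max B B') := (le_max_right _ _).trans (le_max_right _ _)
  intro i
  fin_cases i
  · exact ⟨hl.trans h1, (hB D t ht).trans h3⟩
  · exact ⟨hl.trans h2, (hB' D t ht).trans h4⟩

end Bounds

/-! ### Consistency of the discrete kernels -/

variable {φ : ℝ → ℝ} {C c : ℝ}

theorem cov2_mem_PSD2_iff {R a b e : ℝ} :
    cov2 a b e ∈ PSD2 R ↔
      (cov2 a b e).PosSemidef ∧ (1 / R ≤ a ∧ a ≤ R) ∧ 1 / R ≤ e ∧ e ≤ R := by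
  simp [PSD2, cov2, Fin.forall_fin_two]

theorem cov2_self_posSemidef {a : ℝ} (ha : 0 ≤ a) : (cov2 a a a).PosSemidef :=
  cov2_posSemidef_iff.2 ⟨ha, ha, (sq a).le⟩

theorem cov2_left_mem_PSD2 {R a b e : ℝ} (h : cov2 a b e ∈ PSD2 R) : cov2 a a a ∈ PSD2 R := by
  obtain ⟨h0, h1, -⟩ := cov2_mem_PSD2_iff.1 h
  exact cov2_mem_PSD2_iff.2 ⟨cov2_self_posSemidef (cov2_posSemidef_iff.1 h0).1, h1, h1⟩

theorem cov2_right_mem_PSD2 {R a b e : ℝ} (h : cov2 a b e ∈ PSD2 R) : cov2 e e e ∈ PSD2 R := by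
  obtain ⟨h0, -, h1⟩ := cov2_mem_PSD2_iff.1 h
  exact cov2_mem_PSD2_iff.2 ⟨cov2_self_posSemidef (cov2_posSemidef_iff.1 h0).2.1, h1, h1⟩

theorem PSD2_mono {R R' : ℝ} (hR : 0 < R) (h : R ≤ R') : PSD2 R ⊆ PSD2 R' := fun _ hS =>
  ⟨hS.1, fun i => ⟨(one_div_le_one_div_of_le hR h).trans (hS.2 i).1, (hS.2 i).2.trans h⟩⟩

theorem cov2_mem_PSD2_of_tendsto {R : ℝ} {a b e : ℕ → ℝ} {a' b' e' : ℝ}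
    (ha : Tendsto a atTop (𝓝 a')) (hb : Tendsto b atTop (𝓝 b')) (he : Tendsto e atTop (𝓝 e'))
    (h : ∀ n, cov2 (a n) (b n) (e n) ∈ PSD2 R) : cov2 a' b' e' ∈ PSD2 R := by
  simp only [cov2_mem_PSD2_iff, cov2_posSemidef_iff] at h ⊢
  exact ⟨⟨ge_of_tendsto' ha fun n => (h n).1.1, ge_of_tendsto' he fun n => (h n).1.2.1,
      le_of_tendsto_of_tendsto' (hb.pow 2) (ha.mul he) fun n => (h n).1.2.2⟩,
    ⟨ge_of_tendsto' ha fun n => (h n).2.1.1, le_of_tendsto' ha fun n => (h n).2.1.2⟩,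
    ge_of_tendsto' he fun n => (h n).2.2.1, le_of_tendsto' he fun n => (h n).2.2.2⟩

/-- `L` is a Lipschitz constant of `V_φ` on `PSD_2(R)`. -/
def VLipschitz (φ : ℝ → ℝ) (R L : ℝ) : Prop :=
  ∀ a b e a' b' e' : ℝ, cov2 a b e ∈ PSD2 R → cov2 a' b' e' ∈ PSD2 R →
    |V φ (cov2 a b e) - V φ (cov2 a' b' e')| ≤ L * (|a - a'| + |b - b'| + |e - e'|)

section Integrand

variable {R L : ℝ} {σA σb : ℝ} {x y : PathSpace d}

theorem VLipschitz.continuousOn (hL : VLipschitz φ R L) {kxx kxy kyy : ℝ → ℝ} {s : Set ℝ}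
    (hxx : ContinuousOn kxx s) (hxy : ContinuousOn kxy s) (hyy : ContinuousOn kyy s)
    (hm : ∀ t ∈ s, cov2 (kxx t) (kxy t) (kyy t) ∈ PSD2 R) :
    ContinuousOn (fun t => V φ (cov2 (kxx t) (kxy t) (kyy t))) s := by
  intro t ht
  rw [ContinuousWithinAt, tendsto_iff_norm_sub_tendsto_zero]
  have h : ContinuousWithinAt
      (fun r => L * (|kxx r - kxx t| + |kxy r - kxy t| + |kyy r - kyy t|)) s t := by
    have h1 := hxx t ht
    have h2 := hxy t ht
    have h3 := hyy t ht
    exact continuousWithinAt_const.mul ((((h1.sub continuousWithinAt_const).abs).add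
      ((h2.sub continuousWithinAt_const).abs)).add ((h3.sub continuousWithinAt_const).abs))
  have h0 := h.tendsto
  simp only [sub_self, abs_zero, add_zero, mul_zero] at h0
  refine squeeze_zero' (Eventually.of_forall fun _ => norm_nonneg _) ?_ h0
  filter_upwards [self_mem_nhdsWithin] with r hr
  exact hL _ _ _ _ _ _ (hm r hr) (hm t ht)

theorem VLipschitz.intervalIntegrable_kernelIntegrand (hL : VLipschitz φ R L)
    {kxx kxy kyy : ℝ → ℝ} (hxx : ContinuousOn kxx (Icc 0 1)) (hxy : ContinuousOn kxy (Icc 0 1))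
    (hyy : ContinuousOn kyy (Icc 0 1))
    (hm : ∀ t ∈ Icc (0 : ℝ) 1, cov2 (kxx t) (kxy t) (kyy t) ∈ PSD2 R) :
    IntervalIntegrable (kernelIntegrand φ σA σb x y kxx kxy kyy) volume 0 1 := by
  have h := hL.continuousOn hxx hxy hyy hm
  refine (intervalIntegrable_inner x y).continuousOn_mul ?_
  rw [uIcc_of_le zero_le_one]
  fun_prop

theorem VLipschitz.abs_integral_kernelIntegrand_sub_le (hL : VLipschitz φ R L) (hL0 : 0 ≤ L)
    {kxx kxy kyy lxx lxy lyy w g : ℝ → ℝ}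
    (hkm : ∀ t ∈ Icc (0 : ℝ) 1, cov2 (kxx t) (kxy t) (kyy t) ∈ PSD2 R)
    (hlm : ∀ t ∈ Icc (0 : ℝ) 1, cov2 (lxx t) (lxy t) (lyy t) ∈ PSD2 R)
    (hk : IntervalIntegrable (kernelIntegrand φ σA σb x y kxx kxy kyy) volume 0 1)
    (hl : IntervalIntegrable (kernelIntegrand φ σA σb x y lxx lxy lyy) volume 0 1)
    (hw : IntervalIntegrable w volume 0 1) (hxyw : ∀ s, |inner ℝ (x.dot s) (y.dot s)| ≤ w s)
    (hg : ContinuousOn g (Icc 0 1))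
    (hd : ∀ s ∈ Icc (0 : ℝ) 1, |kxx s - lxx s| + |kxy s - lxy s| + |kyy s - lyy s| ≤ g s)
    {t : ℝ} (ht : t ∈ Icc (0 : ℝ) 1) :
    |(∫ s in (0 : ℝ)..t, kernelIntegrand φ σA σb x y kxx kxy kyy s) -
      ∫ s in (0 : ℝ)..t, kernelIntegrand φ σA σb x y lxx lxy lyy s| ≤
      σA ^ 2 * L * ∫ s in (0 : ℝ)..t, w s * g s := by
  have sub := uIcc_subset_unit le_rfl ht.1 ht.2
  rw [← intervalIntegral.integral_sub (hk.mono_set sub) (hl.mono_set sub),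
    ← intervalIntegral.integral_const_mul, ← Real.norm_eq_abs]
  have hwg : IntervalIntegrable (fun s => w s * g s) volume 0 1 :=
    hw.mul_continuousOn (by rwa [uIcc_of_le zero_le_one])
  refine intervalIntegral.norm_integral_le_of_norm_le ht.1
    (Eventually.of_forall fun s hs => ?_) ((hwg.mono_set sub).const_mul _)
  have hs' : s ∈ Icc (0 : ℝ) 1 := ⟨hs.1.le, hs.2.trans ht.2⟩
  have h1 := hL _ _ _ _ _ _ (hkm s hs') (hlm s hs')
  have h2 := hd s hs'
  have hg0 : 0 ≤ g s := le_trans (by positivity) h2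
  have e : kernelIntegrand φ σA σb x y kxx kxy kyy s - kernelIntegrand φ σA σb x y lxx lxy lyy s =
      σA ^ 2 * (V φ (cov2 (kxx s) (kxy s) (kyy s)) - V φ (cov2 (lxx s) (lxy s) (lyy s))) *
        inner ℝ (x.dot s) (y.dot s) := by
    simp only [kernelIntegrand]; ring
  rw [e, Real.norm_eq_abs, abs_mul, abs_mul, abs_of_nonneg (sq_nonneg σA)]
  calc _ ≤ σA ^ 2 * (L * g s) * w s := by
        gcongr
        · exact h1.trans (by gcongr)
        · exact hxyw s
    _ = _ := by ring

end Integrand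

section Consistency

variable {R L : ℝ} {σa σA σb : ℝ} {x y : PathSpace d}

theorem exists_abs_coeff_le (hlin : LinearlyBounded φ) (hφ : ExpLipschitz φ C c) (σA σb : ℝ)
    (hR : 0 < R) :
    ∃ B, 0 ≤ B ∧ ∀ a b e : ℝ, cov2 a b e ∈ PSD2 R → |σA ^ 2 * V φ (cov2 a b e) + σb ^ 2| ≤ B := by
  obtain ⟨K, hK0, hK⟩ := exists_V_self_le hlin hφ
  refine ⟨σA ^ 2 * (K * (1 + R)) + σb ^ 2, by positivity, fun a b e h => ?_⟩
  obtain ⟨h0, ⟨-, haR⟩, -, heR⟩ := cov2_mem_PSD2_iff.1 h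
  obtain ⟨ha, he, -⟩ := cov2_posSemidef_iff.1 h0
  have key : ∀ a, 0 ≤ a → a ≤ R →
      0 ≤ σA ^ 2 * V φ (cov2 a a a) + σb ^ 2 ∧
      σA ^ 2 * V φ (cov2 a a a) + σb ^ 2 ≤ σA ^ 2 * (K * (1 + R)) + σb ^ 2 := by
    intro a ha haR
    have h1 := hφ.V_self_nonneg ha
    have h2 : V φ (cov2 a a a) ≤ K * (1 + R) := (hK a ha).trans (by gcongr)
    exact ⟨by positivity, by gcongr⟩
  obtain ⟨a0, a1⟩ := key a ha haR
  obtain ⟨e0, e1⟩ := key e he heR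
  exact abs_le_of_sq_le_sq ((hφ.coeff_sq_le σA σb h0).trans
    ((mul_le_mul a1 e1 e0 (by positivity)).trans_eq (sq _).symm)) (by positivity)

/-- The interpolated discrete kernels solve the kernel equation up to an error that vanishes with
the mesh. Two errors are made on each interval: the increments of the paths replace the integral of
`⟨ẋ, ẏ⟩`, and the coefficient is frozen at the left end point. -/
theorem interpKernel_defect_le (hlin : LinearlyBounded φ) (hφ : ExpLipschitz φ C c) (hR : 0 < R)
    (hm : ∀ D : UnitPartition, ∀ t ∈ Icc (0 : ℝ) 1,
      cov2 (interpKernel φ σa σA σb D x x t) (interpKernel φ σa σA σb D x y t)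
        (interpKernel φ σa σA σb D y y t) ∈ PSD2 R) {η : ℝ} (hη : 0 < η) :
    ∃ δ > 0, ∀ D : UnitPartition, D.mesh < δ → ∀ t ∈ Icc (0 : ℝ) 1,
      |interpKernel φ σa σA σb D x y t - σa ^ 2 - ∫ s in (0 : ℝ)..t,
        kernelIntegrand φ σA σb x y (interpKernel φ σa σA σb D x x)
          (interpKernel φ σa σA σb D x y) (interpKernel φ σa σA σb D y y) s| ≤ η := by
  obtain ⟨L, hL0, hL⟩ := hφ.exists_V_lipschitz hR
  have hL : VLipschitz φ R L := hL
  obtain ⟨B, hB0, hB⟩ := exists_abs_coeff_le hlin hφ σA σb hR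
  set e0 := ∫ s in (0 : ℝ)..1, energy x y s
  have he0 : 0 ≤ e0 := intervalIntegral.integral_nonneg zero_le_one fun s _ => energy_nonneg x y s
  -- `ε₁` bounds the squared `L²` distance of each derivative to its local means, and `B * ε₂` the
  -- oscillation of the covariance matrix on one interval; each accounts for half of `η`
  obtain ⟨ε₁, hε₁, hε₁'⟩ : ∃ ε₁ > 0, B * (2 * ε₁) ≤ η / 2 := by
    refine ⟨η / (4 * (B + 1)), by positivity, ?_⟩
    rw [show B * (2 * (η / (4 * (B + 1)))) = (B / (B + 1)) * (η / 2) by field_simp; norm_num]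
    exact mul_le_of_le_one_left (by positivity) ((div_le_one (by positivity)).2 (by linarith))
  set Q := σA ^ 2 * L * B
  have hQ : 0 ≤ Q := by positivity
  obtain ⟨ε₂, hε₂, hε₂'⟩ : ∃ ε₂ > 0, Q * ε₂ * e0 ≤ η / 2 := by
    refine ⟨η / (2 * (Q * e0 + 1)), by positivity, ?_⟩
    rw [show Q * (η / (2 * (Q * e0 + 1))) * e0 = (Q * e0 / (Q * e0 + 1)) * (η / 2) by field_simp]
    exact mul_le_of_le_one_left (by positivity) ((div_le_one (by positivity)).2 (by linarith))
  obtain ⟨δ₁, hδ₁, h₁, hi₁, hp₁, hs₁, ha₁⟩ := exists_local_const_approx x.memLp_dot hε₁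
  obtain ⟨δ₂, hδ₂, h₂, hi₂, hp₂, hs₂, ha₂⟩ := exists_local_const_approx y.memLp_dot hε₁
  have hTi := ((intervalIntegrable_energy x x).add (intervalIntegrable_energy x y)).add
    (intervalIntegrable_energy y y)
  obtain ⟨δ₃, hδ₃, hT⟩ := exists_small_integral hTi hε₂
  refine ⟨min δ₁ (min δ₂ δ₃), by positivity, fun D hD t ht => ?_⟩
  have hD₁ : D.mesh < δ₁ := hD.trans_le (min_le_left _ _)
  have hD₂ : D.mesh < δ₂ := hD.trans_le ((min_le_right _ _).trans (min_le_left _ _))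
  have hD₃ : D.mesh < δ₃ := hD.trans_le ((min_le_right _ _).trans (min_le_right _ _))
  have hmD := hm D
  have stepx := fun m (hm : m < D.n) t ht => interpKernel_step φ σa σA σb D x x hm (t := t) ht
  have step := fun m (hm : m < D.n) t ht => interpKernel_step φ σa σA σb D x y hm (t := t) ht
  have stepy := fun m (hm : m < D.n) t ht => interpKernel_step φ σa σA σb D y y hm (t := t) ht
  have hint := hL.intervalIntegrable_kernelIntegrand (σA := σA) (σb := σb) (x := x) (y := y)
    (continuousOn_interpKernel φ σa σA σb D x x)
    (continuousOn_interpKernel φ σa σA σb D x y) (continuousOn_interpKernel φ σa σA σb D y y) hmD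
  have hz := interpKernel_zero φ σa σA σb D x y
  generalize interpKernel φ σa σA σb D x x = kx at *
  generalize interpKernel φ σa σA σb D x y = k at *
  generalize interpKernel φ σa σA σb D y y = ky at *
  -- the two errors together are bounded by an additive function of the interval
  set H : ℝ → ℝ := fun s => B * (h₁ s + h₂ s) + Q * ε₂ * energy x y s
  have i12 := hi₁.add hi₂
  have iE := intervalIntegrable_energy x y
  have hH : IntervalIntegrable H volume 0 1 := (i12.const_mul B).add (iE.const_mul (Q * ε₂))
  have hHint : ∀ u t, 0 ≤ u → u ≤ t → t ≤ 1 → ∫ s in u..t, H s =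
      B * ((∫ s in u..t, h₁ s) + ∫ s in u..t, h₂ s) + Q * ε₂ * ∫ s in u..t, energy x y s := by
    intro u t hu hut ht
    have sub := uIcc_subset_unit hu hut ht
    rw [intervalIntegral.integral_add ((i12.mono_set sub).const_mul B)
      ((iE.mono_set sub).const_mul (Q * ε₂)), intervalIntegral.integral_const_mul,
      intervalIntegral.integral_const_mul,
      intervalIntegral.integral_add (hi₁.mono_set sub) (hi₂.mono_set sub)]
  have main : |k t - σa ^ 2 - ∫ s in (0 : ℝ)..t, kernelIntegrand φ σA σb x y kx k ky s| ≤
      ∫ s in (0 : ℝ)..t, H s := by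
    refine D.induction_on (P := fun t => |k t - σa ^ 2 -
      ∫ s in (0 : ℝ)..t, kernelIntegrand φ σA σb x y kx k ky s| ≤ ∫ s in (0 : ℝ)..t, H s)
      (by simp [hz]) (fun m hm h t ht => ?_) t ht
    obtain ⟨u, hu⟩ : ∃ u, u = D.pt m := ⟨_, rfl⟩
    have hu0 : 0 ≤ u := hu ▸ (D.pt_mem hm.le).1
    have hut : u ≤ t := hu ▸ ht.1
    have ht1 : t ≤ 1 := ht.2.trans (D.pt_mem (Nat.succ_le_of_lt hm)).2
    have hmesh : ∀ s ≤ t, s - u ≤ D.mesh := by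
      intro s hs
      have := D.sub_le_mesh hm
      rw [← hu] at this
      linarith [ht.2]
    have hst := step m hm t ht
    -- the covariance matrix moves little within one interval
    have hstep : ∀ s ∈ Icc u t, |kx u - kx s| + |k u - k s| + |ky u - ky s| ≤ B * ε₂ := by
      intro s hs
      have hs' : s ∈ Icc (D.pt m) (D.pt (m + 1)) := hu ▸ ⟨hs.1, (hs.2.trans ht.2)⟩
      have hs1 := hs.2.trans ht1
      have huI : u ∈ Icc (0 : ℝ) 1 := ⟨hu0, hut.trans ht1⟩
      have d : ∀ {q : ℝ} {z z' : PathSpace d}, |q| ≤ B →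
          |q * chord z z' u s| ≤ B * ∫ r in u..s, energy z z' r := by
        intro q z z' hq
        rw [abs_mul]
        exact mul_le_mul hq (abs_chord_le z z' hu0 hs.1 hs1) (abs_nonneg _) hB0
      have c1 := d (z := x) (z' := x) (hB _ _ _ (cov2_left_mem_PSD2 (hmD u huI)))
      have c2 := d (z := x) (z' := y) (hB _ _ _ (hmD u huI))
      have c3 := d (z := y) (z' := y) (hB _ _ _ (cov2_right_mem_PSD2 (hmD u huI)))
      have s1 := stepx m hm s hs'
      have s2 := step m hm s hs'
      have s3 := stepy m hm s hs'
      rw [← hu] at s1 s2 s3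
      have t0 := (le_abs_self _).trans (hT u s hu0 hs.1 hs1 ((hmesh s hs.2).trans_lt hD₃))
      have sub := uIcc_subset_unit hu0 hs.1 hs1
      have t1 : ∫ r in u..s, (energy x x r + energy x y r + energy y y r) =
          (∫ r in u..s, energy x x r) + (∫ r in u..s, energy x y r) +
            ∫ r in u..s, energy y y r := by
        rw [intervalIntegral.integral_add
          (((intervalIntegrable_energy x x).mono_set sub).add (iE.mono_set sub))
          ((intervalIntegrable_energy y y).mono_set sub),
          intervalIntegral.integral_add ((intervalIntegrable_energy x x).mono_set sub)
          (iE.mono_set sub)]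
      have t2 := mul_le_mul_of_nonneg_left (t1 ▸ t0) hB0
      rw [s1, s2, s3]
      simp only [sub_add_cancel_left, abs_neg]
      linarith
    -- the increment of the paths against the integral of the scalar product of the derivatives
    have hch : |chord x y u t - ∫ s in u..t, inner ℝ (x.dot s) (y.dot s)| ≤
        (∫ s in u..t, h₁ s) + ∫ s in u..t, h₂ s := by
      rcases hut.eq_or_lt with rfl | hlt
      · simp [chord_self]
      obtain ⟨a, ha⟩ := ha₁ u t hu0 hut ht1 ((hmesh t le_rfl).trans_lt hD₁)
      obtain ⟨b, hb⟩ := ha₂ u t hu0 hut ht1 ((hmesh t le_rfl).trans_lt hD₂)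
      have := abs_chord_sub_integral_inner_le hlt (x.memLp_dot_Ioc hu0 ht1)
        (y.memLp_dot_Ioc hu0 ht1) a b
      rw [← x.eval_sub hu0 hut ht1, ← y.eval_sub hu0 hut ht1] at this
      exact this.trans (add_le_add ha hb)
    set q := σA ^ 2 * V φ (cov2 (kx u) (k u) (ky u)) + σb ^ 2 with hq
    have huI : u ∈ Icc (0 : ℝ) 1 := ⟨hu0, hut.trans ht1⟩
    have hqB : |q| ≤ B := hB _ _ _ (hmD u huI)
    have sub := uIcc_subset_unit hu0 hut ht1
    have iI := (intervalIntegrable_inner x y).mono_set sub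
    -- the frozen coefficient
    have hfr : |q * (∫ s in u..t, inner ℝ (x.dot s) (y.dot s)) -
        ∫ s in u..t, kernelIntegrand φ σA σb x y kx k ky s| ≤
        Q * ε₂ * ∫ s in u..t, energy x y s := by
      rw [← intervalIntegral.integral_const_mul, ← intervalIntegral.integral_const_mul,
        ← intervalIntegral.integral_sub (iI.const_mul q) (hint.mono_set sub), ← Real.norm_eq_abs]
      refine intervalIntegral.norm_integral_le_of_norm_le hut
        (Eventually.of_forall fun s hs => ?_) ((iE.mono_set sub).const_mul _)
      have hsI : s ∈ Icc (0 : ℝ) 1 := ⟨hu0.trans hs.1.le, hs.2.trans ht1⟩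
      have e : q * inner ℝ (x.dot s) (y.dot s) - kernelIntegrand φ σA σb x y kx k ky s =
          σA ^ 2 * (V φ (cov2 (kx u) (k u) (ky u)) - V φ (cov2 (kx s) (k s) (ky s))) *
            inner ℝ (x.dot s) (y.dot s) := by
        simp only [kernelIntegrand, hq]; ring
      rw [e, Real.norm_eq_abs, abs_mul, abs_mul, abs_of_nonneg (sq_nonneg σA)]
      have h1 := hL _ _ _ _ _ _ (hmD u huI) (hmD s hsI)
      have h2 := hstep s ⟨hs.1.le, hs.2⟩
      calc _ ≤ σA ^ 2 * (L * (B * ε₂)) * energy x y s := by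
            gcongr
            · exact h1.trans (by gcongr)
            · exact abs_inner_dot_le x y s
        _ = _ := by simp only [Q]; ring
    rw [← hu] at h hst
    rw [← sub_add_cancel (∫ s in (0 : ℝ)..t, H s) (∫ s in (0 : ℝ)..u, H s),
      integral_sub_integral hH hu0 hut ht1, hHint u t hu0 hut ht1,
      ← sub_add_cancel (∫ s in (0 : ℝ)..t, kernelIntegrand φ σA σb x y kx k ky s)
        (∫ s in (0 : ℝ)..u, kernelIntegrand φ σA σb x y kx k ky s),
      integral_sub_integral hint hu0 hut ht1, hst]
    have hqc : |q * (chord x y u t - ∫ s in u..t, inner ℝ (x.dot s) (y.dot s))| ≤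
        B * ((∫ s in u..t, h₁ s) + ∫ s in u..t, h₂ s) := by
      rw [abs_mul]
      exact mul_le_mul hqB hch (abs_nonneg _) hB0
    rw [abs_le] at *
    constructor <;> linarith [h.1, h.2, hfr.1, hfr.2, hqc.1, hqc.2]
  refine main.trans ?_
  have hH0 : ∀ s, 0 ≤ H s := fun s => by
    have := hp₁ s
    have := hp₂ s
    have := energy_nonneg x y s
    simp only [H]
    positivity
  have hle : ∫ s in (0 : ℝ)..t, H s ≤ ∫ s in (0 : ℝ)..1, H s := by
    rw [← sub_nonneg, integral_sub_integral hH ht.1 ht.2 le_rfl]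
    exact intervalIntegral.integral_nonneg ht.2 fun s _ => hH0 s
  refine hle.trans ?_
  rw [hHint 0 1 le_rfl zero_le_one le_rfl]
  have : B * ((∫ s in (0 : ℝ)..1, h₁ s) + ∫ s in (0 : ℝ)..1, h₂ s) ≤ B * (2 * ε₁) := by
    gcongr; linarith
  linarith

end Consistency

/-! ### Stability, existence, uniqueness and convergence -/

/-- `kxy` satisfies the kernel equation for the pair `(x, y)` up to an error `η`. -/
def ApproxEquation (φ : ℝ → ℝ) (σa σA σb : ℝ) (x y : PathSpace d) (η : ℝ)
    (kxx kxy kyy : ℝ → ℝ) : Prop :=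
  ∀ t ∈ Icc (0 : ℝ) 1,
    |kxy t - σa ^ 2 - ∫ s in (0 : ℝ)..t, kernelIntegrand φ σA σb x y kxx kxy kyy s| ≤ η

/-- A continuous triple with covariance matrices in `PSD_2(R)` that satisfies the kernel equations
for the pairs `(x, x)`, `(x, y)` and `(y, y)` up to an error `η`. -/
structure IsApproxSolution (φ : ℝ → ℝ) (σa σA σb : ℝ) (x y : PathSpace d) (R η : ℝ)
    (kxx kxy kyy : ℝ → ℝ) : Prop where
  cont_xx : ContinuousOn kxx (Icc 0 1)
  cont_xy : ContinuousOn kxy (Icc 0 1)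
  cont_yy : ContinuousOn kyy (Icc 0 1)
  mem_PSD2 : ∀ t ∈ Icc (0 : ℝ) 1, cov2 (kxx t) (kxy t) (kyy t) ∈ PSD2 R
  eq_xx : ApproxEquation φ σa σA σb x x η kxx kxx kxx
  eq_xy : ApproxEquation φ σa σA σb x y η kxx kxy kyy
  eq_yy : ApproxEquation φ σa σA σb y y η kyy kyy kyy

section Stability

variable {R : ℝ} {σa σA σb : ℝ} {x y : PathSpace d}

theorem ApproxEquation.abs_sub_le {L η : ℝ} (hL : VLipschitz φ R L) (hL0 : 0 ≤ L)
    {kxx kxy kyy lxx lxy lyy w E : ℝ → ℝ}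
    (hk : ApproxEquation φ σa σA σb x y η kxx kxy kyy)
    (hl : ApproxEquation φ σa σA σb x y η lxx lxy lyy)
    (hkxx : ContinuousOn kxx (Icc 0 1)) (hkxy : ContinuousOn kxy (Icc 0 1))
    (hkyy : ContinuousOn kyy (Icc 0 1)) (hlxx : ContinuousOn lxx (Icc 0 1))
    (hlxy : ContinuousOn lxy (Icc 0 1)) (hlyy : ContinuousOn lyy (Icc 0 1))
    (hkm : ∀ t ∈ Icc (0 : ℝ) 1, cov2 (kxx t) (kxy t) (kyy t) ∈ PSD2 R)
    (hlm : ∀ t ∈ Icc (0 : ℝ) 1, cov2 (lxx t) (lxy t) (lyy t) ∈ PSD2 R)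
    (hw : IntervalIntegrable w volume 0 1) (hxyw : ∀ s, |inner ℝ (x.dot s) (y.dot s)| ≤ w s)
    (hE : ContinuousOn E (Icc 0 1))
    (hd : ∀ s ∈ Icc (0 : ℝ) 1, |kxx s - lxx s| + |kxy s - lxy s| + |kyy s - lyy s| ≤ 3 * E s)
    {t : ℝ} (ht : t ∈ Icc (0 : ℝ) 1) :
    |kxy t - lxy t| ≤ 2 * η + 3 * (σA ^ 2 * L) * ∫ s in (0 : ℝ)..t, w s * E s := by
  have h := hL.abs_integral_kernelIntegrand_sub_le (σA := σA) (σb := σb) hL0 hkm hlm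
    (hL.intervalIntegrable_kernelIntegrand hkxx hkxy hkyy hkm)
    (hL.intervalIntegrable_kernelIntegrand hlxx hlxy hlyy hlm) hw hxyw (hE.const_mul 3) hd ht
  have e : ∫ s in (0 : ℝ)..t, w s * (3 * E s) = 3 * ∫ s in (0 : ℝ)..t, w s * E s := by
    rw [← intervalIntegral.integral_const_mul]
    congr 1; ext s; ring
  rw [e] at h
  have h1 := hk t ht
  have h2 := hl t ht
  rw [abs_le] at *
  constructor <;> linarith [h.1, h.2, h1.1, h1.2, h2.1, h2.2]

/-- Stability of the kernel equation: two approximate solutions differ by a multiple of their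
errors. -/
theorem exists_stability_const (hφ : ExpLipschitz φ C c) (hR : 0 < R) (σa σA σb : ℝ)
    (x y : PathSpace d) :
    ∃ A, 0 ≤ A ∧ ∀ (η : ℝ) (kxx kxy kyy lxx lxy lyy : ℝ → ℝ), 0 ≤ η →
      IsApproxSolution φ σa σA σb x y R η kxx kxy kyy →
      IsApproxSolution φ σa σA σb x y R η lxx lxy lyy →
      ∀ t ∈ Icc (0 : ℝ) 1, |kxx t - lxx t| + |kxy t - lxy t| + |kyy t - lyy t| ≤ A * η := by
  obtain ⟨L, hL0, hL⟩ := hφ.exists_V_lipschitz hR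
  have hL : VLipschitz φ R L := hL
  set w : ℝ → ℝ := fun s => energy x x s + energy x y s + energy y y s with hwdef
  have hw : IntervalIntegrable w volume 0 1 :=
    ((intervalIntegrable_energy x x).add (intervalIntegrable_energy x y)).add
      (intervalIntegrable_energy y y)
  have hw0 : ∀ s, 0 ≤ w s := fun s => add_nonneg
    (add_nonneg (energy_nonneg x x s) (energy_nonneg x y s)) (energy_nonneg y y s)
  refine ⟨2 * 6 * Real.exp (2 * (9 * (σA ^ 2 * L)) * ∫ s in (0 : ℝ)..1, w s), by positivity, ?_⟩
  intro η kxx kxy kyy lxx lxy lyy hη hk hl t ht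
  -- each of the three differences of integrands is controlled by three times the total difference
  set E : ℝ → ℝ := fun t => |kxx t - lxx t| + |kxy t - lxy t| + |kyy t - lyy t| with hEdef
  have hE : ContinuousOn E (Icc 0 1) :=
    (((hk.cont_xx.sub hl.cont_xx).abs).add ((hk.cont_xy.sub hl.cont_xy).abs)).add
      ((hk.cont_yy.sub hl.cont_yy).abs)
  have hwx : ∀ s, |inner ℝ (x.dot s) (x.dot s)| ≤ w s := fun s => by
    linarith [abs_inner_dot_le x x s, energy_nonneg x y s, energy_nonneg y y s]
  have hwxy : ∀ s, |inner ℝ (x.dot s) (y.dot s)| ≤ w s := fun s => by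
    linarith [abs_inner_dot_le x y s, energy_nonneg x x s, energy_nonneg y y s]
  have hwy : ∀ s, |inner ℝ (y.dot s) (y.dot s)| ≤ w s := fun s => by
    linarith [abs_inner_dot_le y y s, energy_nonneg x y s, energy_nonneg x x s]
  have p1 : ∀ s, 0 ≤ |kxx s - lxx s| := fun s => abs_nonneg _
  have p2 : ∀ s, 0 ≤ |kxy s - lxy s| := fun s => abs_nonneg _
  have p3 : ∀ s, 0 ≤ |kyy s - lyy s| := fun s => abs_nonneg _
  have key := gronwall_integrable_weight (η := 6 * η) (L := 9 * (σA ^ 2 * L)) hE hw hw0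
    (by positivity) (fun t ht => ?_) (by positivity) t ht
  · refine key.trans (le_of_eq ?_)
    ring
  · have h1 := hk.eq_xx.abs_sub_le hL hL0 hl.eq_xx hk.cont_xx hk.cont_xx hk.cont_xx hl.cont_xx
      hl.cont_xx hl.cont_xx (fun t ht => cov2_left_mem_PSD2 (hk.mem_PSD2 t ht))
      (fun t ht => cov2_left_mem_PSD2 (hl.mem_PSD2 t ht)) hw hwx hE
      (fun s _ => by simp only [hEdef]; linarith [p1 s, p2 s, p3 s]) ht
    have h2 := hk.eq_xy.abs_sub_le hL hL0 hl.eq_xy hk.cont_xx hk.cont_xy hk.cont_yy hl.cont_xx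
      hl.cont_xy hl.cont_yy hk.mem_PSD2 hl.mem_PSD2 hw hwxy hE
      (fun s _ => by simp only [hEdef]; linarith [p1 s, p2 s, p3 s]) ht
    have h3 := hk.eq_yy.abs_sub_le hL hL0 hl.eq_yy hk.cont_yy hk.cont_yy hk.cont_yy hl.cont_yy
      hl.cont_yy hl.cont_yy (fun t ht => cov2_right_mem_PSD2 (hk.mem_PSD2 t ht))
      (fun t ht => cov2_right_mem_PSD2 (hl.mem_PSD2 t ht)) hw hwy hE
      (fun s _ => by simp only [hEdef]; linarith [p1 s, p2 s, p3 s]) ht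
    change |kxx t - lxx t| + |kxy t - lxy t| + |kyy t - lyy t| ≤ _
    linarith

theorem IsApproxSolution.mono {R' η η' : ℝ} {kxx kxy kyy : ℝ → ℝ} (hR : 0 < R) (hRR : R ≤ R')
    (hη : η ≤ η') (h : IsApproxSolution φ σa σA σb x y R η kxx kxy kyy) :
    IsApproxSolution φ σa σA σb x y R' η' kxx kxy kyy :=
  ⟨h.cont_xx, h.cont_xy, h.cont_yy, fun t ht => PSD2_mono hR hRR (h.mem_PSD2 t ht),
    fun t ht => (h.eq_xx t ht).trans hη, fun t ht => (h.eq_xy t ht).trans hη,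
    fun t ht => (h.eq_yy t ht).trans hη⟩

end Stability

section Solutions

variable {R : ℝ} {σa σA σb : ℝ} {x y : PathSpace d}

theorem SatisfiesEquation.continuousOn {kxx kxy kyy : ℝ → ℝ}
    (h : SatisfiesEquation φ σa σA σb x y kxx kxy kyy) : ContinuousOn kxy (Icc 0 1) :=
  (continuousOn_const.add (continuousOn_primitive h.1)).congr h.2

theorem SatisfiesEquation.approxEquation {kxx kxy kyy : ℝ → ℝ}
    (h : SatisfiesEquation φ σa σA σb x y kxx kxy kyy) :
    ApproxEquation φ σa σA σb x y 0 kxx kxy kyy := by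
  intro t ht
  rw [h.2 t ht]
  simp

theorem SatisfiesEquation.le_self (hφ : ExpLipschitz φ C c) {k : ℝ → ℝ}
    (h : SatisfiesEquation φ σa σA σb x x k k k) (hk : ∀ t ∈ Icc (0 : ℝ) 1, 0 ≤ k t) {t : ℝ}
    (ht : t ∈ Icc (0 : ℝ) 1) : σa ^ 2 ≤ k t := by
  rw [h.2 t ht, le_add_iff_nonneg_right]
  refine intervalIntegral.integral_nonneg ht.1 fun s hs => ?_
  have := hφ.V_self_nonneg (hk s ⟨hs.1, hs.2.trans ht.2⟩)
  exact mul_nonneg (by positivity) real_inner_self_nonneg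

/-- A solution of the kernel equation stays in some `PSD_2(R)`: it is continuous, and the diagonal
entries are at least `σ_a²`. -/
theorem IsKernelSolution.exists_isApproxSolution (hφ : ExpLipschitz φ C c) (hσa : 0 < σa)
    {kxx kxy kyy : ℝ → ℝ} (h : IsKernelSolution φ σa σA σb x y kxx kxy kyy) :
    ∃ R, 0 < R ∧ IsApproxSolution φ σa σA σb x y R 0 kxx kxy kyy := by
  have hxx := fun t ht => (cov2_posSemidef_iff.1 (h.posSemidef t ht)).1
  have hyy := fun t ht => (cov2_posSemidef_iff.1 (h.posSemidef t ht)).2.1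
  obtain ⟨B, hB⟩ := isCompact_Icc.bddAbove_image h.eq_xx.continuousOn
  obtain ⟨B', hB'⟩ := isCompact_Icc.bddAbove_image h.eq_yy.continuousOn
  have hs : 0 < σa ^ 2 := by positivity
  have hR : 0 < max (1 / σa ^ 2) (max B B') := lt_max_of_lt_left (by positivity)
  have hl : 1 / max (1 / σa ^ 2) (max B B') ≤ σa ^ 2 := by
    rw [one_div_le hR hs]
    exact le_max_left _ _
  refine ⟨_, hR, h.eq_xx.continuousOn, h.eq_xy.continuousOn, h.eq_yy.continuousOn,
    fun t ht => cov2_mem_PSD2_iff.2 ⟨h.posSemidef t ht,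
      ⟨hl.trans (h.eq_xx.le_self hφ hxx ht), (hB (mem_image_of_mem _ ht)).trans
        ((le_max_left _ _).trans (le_max_right _ _))⟩,
      hl.trans (h.eq_yy.le_self hφ hyy ht), (hB' (mem_image_of_mem _ ht)).trans
        ((le_max_right _ _).trans (le_max_right _ _))⟩,
    h.eq_xx.approxEquation, h.eq_xy.approxEquation, h.eq_yy.approxEquation⟩

theorem exists_isApproxSolution_interpKernel (hlin : LinearlyBounded φ) (hφ : ExpLipschitz φ C c)
    (hR : 0 < R)
    (hm : ∀ D : UnitPartition, ∀ t ∈ Icc (0 : ℝ) 1,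
      cov2 (interpKernel φ σa σA σb D x x t) (interpKernel φ σa σA σb D x y t)
        (interpKernel φ σa σA σb D y y t) ∈ PSD2 R) {η : ℝ} (hη : 0 < η) :
    ∃ δ > 0, ∀ D : UnitPartition, D.mesh < δ → IsApproxSolution φ σa σA σb x y R η
      (interpKernel φ σa σA σb D x x) (interpKernel φ σa σA σb D x y)
      (interpKernel φ σa σA σb D y y) := by
  obtain ⟨δ₁, hδ₁, h₁⟩ := interpKernel_defect_le (x := x) (y := x) hlin hφ hR
    (fun D t ht => cov2_left_mem_PSD2 (hm D t ht)) hη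
  obtain ⟨δ₂, hδ₂, h₂⟩ := interpKernel_defect_le (x := x) (y := y) hlin hφ hR hm hη
  obtain ⟨δ₃, hδ₃, h₃⟩ := interpKernel_defect_le (x := y) (y := y) hlin hφ hR
    (fun D t ht => cov2_right_mem_PSD2 (hm D t ht)) hη
  exact ⟨min δ₁ (min δ₂ δ₃), by positivity, fun D hD =>
    ⟨continuousOn_interpKernel φ σa σA σb D x x, continuousOn_interpKernel φ σa σA σb D x y,
      continuousOn_interpKernel φ σa σA σb D y y, hm D,
      h₁ D (hD.trans_le (min_le_left _ _)),
      h₂ D (hD.trans_le ((min_le_right _ _).trans (min_le_left _ _))),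
      h₃ D (hD.trans_le ((min_le_right _ _).trans (min_le_right _ _)))⟩⟩

/-- The limit of the interpolated discrete kernels along the uniform partitions. -/
noncomputable def limitKernel (φ : ℝ → ℝ) (σa σA σb : ℝ) (x y : PathSpace d) (t : ℝ) : ℝ :=
  limUnder atTop fun M => interpKernel φ σa σA σb (UnitPartition.uniform M) x y t

theorem tendsto_mesh_uniform :
    Tendsto (fun M => (UnitPartition.uniform M).mesh) atTop (𝓝 0) := by
  simp only [UnitPartition.mesh_uniform]
  exact tendsto_one_div_add_atTop_nhds_zero_nat

theorem exists_abs_interpKernel_sub_limitKernel_le (hlin : LinearlyBounded φ)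
    (hφ : ExpLipschitz φ C c) (hσa : 0 < σa) (σA σb : ℝ) (x y : PathSpace d) {ε : ℝ}
    (hε : 0 < ε) :
    ∃ δ > 0, ∀ D : UnitPartition, D.mesh < δ → ∀ t ∈ Icc (0 : ℝ) 1,
      |interpKernel φ σa σA σb D x y t - limitKernel φ σa σA σb x y t| ≤ ε := by
  obtain ⟨R, hR, hm⟩ := exists_interpKernel_mem_PSD2 σa σA σb hlin hφ hσa x y
  obtain ⟨A, hA, hst⟩ := exists_stability_const hφ hR σa σA σb x y
  have key : ∀ ε > 0, ∃ δ > 0, ∀ D D' : UnitPartition, D.mesh < δ → D'.mesh < δ →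
      ∀ t ∈ Icc (0 : ℝ) 1,
        |interpKernel φ σa σA σb D x y t - interpKernel φ σa σA σb D' x y t| ≤ ε := by
    intro ε hε
    have hη : 0 < ε / (A + 1) := by positivity
    obtain ⟨δ, hδ, h⟩ := exists_isApproxSolution_interpKernel hlin hφ hR hm hη
    refine ⟨δ, hδ, fun D D' hD hD' t ht => ?_⟩
    have h1 := hst _ _ _ _ _ _ _ hη.le (h D hD) (h D' hD') t ht
    have h2 : A * (ε / (A + 1)) ≤ ε := by
      rw [show A * (ε / (A + 1)) = A / (A + 1) * ε by field_simp]
      exact mul_le_of_le_one_left hε.le ((div_le_one (by positivity)).2 (by linarith))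
    linarith [abs_nonneg (interpKernel φ σa σA σb D x x t - interpKernel φ σa σA σb D' x x t),
      abs_nonneg (interpKernel φ σa σA σb D y y t - interpKernel φ σa σA σb D' y y t)]
  have hlim : ∀ t ∈ Icc (0 : ℝ) 1, Tendsto
      (fun M => interpKernel φ σa σA σb (UnitPartition.uniform M) x y t) atTop
      (𝓝 (limitKernel φ σa σA σb x y t)) := by
    intro t ht
    refine CauchySeq.tendsto_limUnder (Metric.cauchySeq_iff.2 fun ε hε => ?_)
    obtain ⟨δ, hδ, h⟩ := key (ε / 2) (half_pos hε)
    obtain ⟨N, hN⟩ := eventually_atTop.1 (tendsto_mesh_uniform.eventually_lt_const hδ)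
    exact ⟨N, fun m hm n hn => (h _ _ (hN m hm) (hN n hn) t ht).trans_lt (half_lt_self hε)⟩
  obtain ⟨δ, hδ, h⟩ := key ε hε
  refine ⟨δ, hδ, fun D hD t ht => ?_⟩
  refine le_of_tendsto ((tendsto_const_nhds.sub (hlim t ht)).abs) ?_
  filter_upwards [tendsto_mesh_uniform.eventually_lt_const hδ] with M hM
  exact h D _ hD hM t ht

theorem tendstoUniformlyOn_interpKernel (hlin : LinearlyBounded φ)
    (hφ : ExpLipschitz φ C c) (hσa : 0 < σa) (σA σb : ℝ) (x y : PathSpace d)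
    {D : ℕ → UnitPartition} (hD : Tendsto (fun M => (D M).mesh) atTop (𝓝 0)) :
    TendstoUniformlyOn (fun M => interpKernel φ σa σA σb (D M) x y)
      (limitKernel φ σa σA σb x y) atTop (Icc 0 1) := by
  rw [Metric.tendstoUniformlyOn_iff]
  intro ε hε
  obtain ⟨δ, hδ, h⟩ := exists_abs_interpKernel_sub_limitKernel_le hlin hφ hσa σA σb x y
    (half_pos hε)
  filter_upwards [hD.eventually_lt_const hδ] with M hM t ht
  rw [dist_comm]
  exact (h _ hM t ht).trans_lt (half_lt_self hε)

theorem continuousOn_limitKernel (hlin : LinearlyBounded φ)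
    (hφ : ExpLipschitz φ C c) (hσa : 0 < σa) (σA σb : ℝ) (x y : PathSpace d) :
    ContinuousOn (limitKernel φ σa σA σb x y) (Icc 0 1) :=
  (tendstoUniformlyOn_interpKernel hlin hφ hσa σA σb x y tendsto_mesh_uniform).continuousOn
    (Frequently.of_forall fun _ => continuousOn_interpKernel φ σa σA σb _ x y)

theorem limitKernel_mem_PSD2 (hlin : LinearlyBounded φ) (hφ : ExpLipschitz φ C c) (hσa : 0 < σa)
    (hm : ∀ D : UnitPartition, ∀ t ∈ Icc (0 : ℝ) 1,
      cov2 (interpKernel φ σa σA σb D x x t) (interpKernel φ σa σA σb D x y t)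
        (interpKernel φ σa σA σb D y y t) ∈ PSD2 R) {t : ℝ} (ht : t ∈ Icc (0 : ℝ) 1) :
    cov2 (limitKernel φ σa σA σb x x t) (limitKernel φ σa σA σb x y t)
      (limitKernel φ σa σA σb y y t) ∈ PSD2 R := by
  have h := fun x y : PathSpace d =>
    (tendstoUniformlyOn_interpKernel hlin hφ hσa σA σb x y tendsto_mesh_uniform).tendsto_at ht
  exact cov2_mem_PSD2_of_tendsto (h x x) (h x y) (h y y) fun M => hm _ t ht

theorem satisfiesEquation_limitKernel (hlin : LinearlyBounded φ) (hφ : ExpLipschitz φ C c)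
    (hσa : 0 < σa) (σA σb : ℝ) (x y : PathSpace d) :
    SatisfiesEquation φ σa σA σb x y (limitKernel φ σa σA σb x x)
      (limitKernel φ σa σA σb x y) (limitKernel φ σa σA σb y y) := by
  obtain ⟨R, hR, hm⟩ := exists_interpKernel_mem_PSD2 σa σA σb hlin hφ hσa x y
  obtain ⟨L, hL0, hL⟩ := hφ.exists_V_lipschitz hR
  have hL : VLipschitz φ R L := hL
  have hc := fun x y : PathSpace d => continuousOn_limitKernel hlin hφ hσa σA σb x y
  have hlm := fun t (ht : t ∈ Icc (0 : ℝ) 1) => limitKernel_mem_PSD2 hlin hφ hσa hm ht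
  have hint := hL.intervalIntegrable_kernelIntegrand (σA := σA) (σb := σb) (x := x) (y := y)
    (hc x x) (hc x y) (hc y y) hlm
  refine ⟨hint, fun t ht => ?_⟩
  set e0 := ∫ s in (0 : ℝ)..t, energy x y s
  have he0 : 0 ≤ e0 := intervalIntegral.integral_nonneg ht.1 fun s _ => energy_nonneg x y s
  rw [← sub_eq_zero, ← abs_eq_zero, ← sub_sub]
  refine le_antisymm (le_of_forall_pos_le_add fun ε hε => ?_) (abs_nonneg _)
  obtain ⟨η, hη, hηε⟩ : ∃ η > 0, (2 + 3 * (σA ^ 2 * L * e0)) * η ≤ ε :=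
    ⟨ε / (2 + 3 * (σA ^ 2 * L * e0)), by positivity, (mul_div_cancel₀ _ (by positivity)).le⟩
  obtain ⟨δ₀, hδ₀, h₀⟩ := interpKernel_defect_le hlin hφ hR hm hη
  obtain ⟨δ₁, hδ₁, h₁⟩ := exists_abs_interpKernel_sub_limitKernel_le hlin hφ hσa σA σb x x hη
  obtain ⟨δ₂, hδ₂, h₂⟩ := exists_abs_interpKernel_sub_limitKernel_le hlin hφ hσa σA σb x y hη
  obtain ⟨δ₃, hδ₃, h₃⟩ := exists_abs_interpKernel_sub_limitKernel_le hlin hφ hσa σA σb y y hη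
  obtain ⟨M, m0, m1, m2, m3⟩ := ((tendsto_mesh_uniform.eventually_lt_const hδ₀).and
    ((tendsto_mesh_uniform.eventually_lt_const hδ₁).and
    ((tendsto_mesh_uniform.eventually_lt_const hδ₂).and
      (tendsto_mesh_uniform.eventually_lt_const hδ₃)))).exists
  generalize UnitPartition.uniform M = D at *
  have h := hL.abs_integral_kernelIntegrand_sub_le (σA := σA) (σb := σb) (g := fun _ => 3 * η)
    hL0 (hm D) hlm (hL.intervalIntegrable_kernelIntegrand
      (continuousOn_interpKernel φ σa σA σb D x x) (continuousOn_interpKernel φ σa σA σb D x y)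
      (continuousOn_interpKernel φ σa σA σb D y y) (hm D)) hint
    (intervalIntegrable_energy x y) (abs_inner_dot_le x y) continuousOn_const
    (fun s hs => by linarith [h₁ D m1 s hs, h₂ D m2 s hs, h₃ D m3 s hs]) ht
  rw [intervalIntegral.integral_mul_const] at h
  have g0 := h₀ D m0 t ht
  have g2 := h₂ D m2 t ht
  change _ ≤ σA ^ 2 * L * (e0 * (3 * η)) at h
  rw [abs_le] at *
  constructor <;> linarith [h.1, h.2, g0.1, g0.2, g2.1, g2.2]

theorem isKernelSolution_limitKernel (hlin : LinearlyBounded φ) (hφ : ExpLipschitz φ C c)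
    (hσa : 0 < σa) (σA σb : ℝ) (x y : PathSpace d) :
    IsKernelSolution φ σa σA σb x y (limitKernel φ σa σA σb x x)
      (limitKernel φ σa σA σb x y) (limitKernel φ σa σA σb y y) := by
  obtain ⟨R, -, hm⟩ := exists_interpKernel_mem_PSD2 σa σA σb hlin hφ hσa x y
  exact ⟨fun t ht => (limitKernel_mem_PSD2 hlin hφ hσa hm ht).1,
    satisfiesEquation_limitKernel hlin hφ hσa σA σb x x,
    satisfiesEquation_limitKernel hlin hφ hσa σA σb x y,
    satisfiesEquation_limitKernel hlin hφ hσa σA σb y y⟩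

theorem IsKernelSolution.eqOn (hφ : ExpLipschitz φ C c) (hσa : 0 < σa)
    {kxx kxy kyy lxx lxy lyy : ℝ → ℝ} (hk : IsKernelSolution φ σa σA σb x y kxx kxy kyy)
    (hl : IsKernelSolution φ σa σA σb x y lxx lxy lyy) :
    EqOn kxx lxx (Icc 0 1) ∧ EqOn kxy lxy (Icc 0 1) ∧ EqOn kyy lyy (Icc 0 1) := by
  obtain ⟨R, hR, hk'⟩ := hk.exists_isApproxSolution hφ hσa
  obtain ⟨R', hR', hl'⟩ := hl.exists_isApproxSolution hφ hσa
  obtain ⟨A, -, hst⟩ := exists_stability_const hφ (lt_max_of_lt_left (b := R) (c := R') hR)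
    σa σA σb x y
  have h := hst 0 _ _ _ _ _ _ le_rfl (hk'.mono hR (le_max_left _ _) le_rfl)
    (hl'.mono hR' (le_max_right _ _) le_rfl)
  simp only [mul_zero] at h
  refine ⟨fun t ht => ?_, fun t ht => ?_, fun t ht => ?_⟩ <;>
  · rw [← sub_eq_zero, ← abs_nonpos_iff]
    linarith [h t ht, abs_nonneg (kxx t - lxx t), abs_nonneg (kxy t - lxy t),
      abs_nonneg (kyy t - lyy t)]

end Solutions

end ControlledResNet

theorem mainTheorem4 (d : ℕ) (φ : ℝ → ℝ)
    (hlin : ControlledResNet.LinearlyBounded φ)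
    (hac : ControlledResNet.ACExpBoundedDeriv φ)
    (σa σA σb : ℝ) (hσa : 0 < σa) (hσA : 0 < σA) (hσb : 0 ≤ σb) :
    ∃ κ : ControlledResNet.PathSpace d → ControlledResNet.PathSpace d → ℝ → ℝ,
      -- `κ x y` is continuous on `[0,1]` and is the unique solution of the kernel equation
      (∀ x y : ControlledResNet.PathSpace d,
        ContinuousOn (κ x y) (Set.Icc 0 1) ∧
        ControlledResNet.IsKernelSolution φ σa σA σb x y (κ x x) (κ x y) (κ y y) ∧
        ∀ kxx kxy kyy : ℝ → ℝ,
          ControlledResNet.IsKernelSolution φ σa σA σb x y kxx kxy kyy →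
            Set.EqOn kxx (κ x x) (Set.Icc 0 1) ∧ Set.EqOn kxy (κ x y) (Set.Icc 0 1) ∧
              Set.EqOn kyy (κ y y) (Set.Icc 0 1)) ∧
      -- the covariance matrices, limiting and discrete, stay in some `PSD_2(R)`
      (∀ x y : ControlledResNet.PathSpace d, ∃ R : ℝ, 0 < R ∧
        (∀ t ∈ Set.Icc (0 : ℝ) 1,
          ControlledResNet.cov2 (κ x x t) (κ x y t) (κ y y t) ∈ ControlledResNet.PSD2 R) ∧
        ∀ D : ControlledResNet.UnitPartition, ∀ t ∈ Set.Icc (0 : ℝ) 1,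
          ControlledResNet.cov2 (ControlledResNet.interpKernel φ σa σA σb D x x t)
            (ControlledResNet.interpKernel φ σa σA σb D x y t)
            (ControlledResNet.interpKernel φ σa σA σb D y y t) ∈ ControlledResNet.PSD2 R) ∧
      -- uniform convergence of the interpolated discrete kernels
      (∀ D : ℕ → ControlledResNet.UnitPartition,
        Filter.Tendsto (fun M => (D M).mesh) Filter.atTop (nhds 0) →
        ∀ x y : ControlledResNet.PathSpace d,
          (∀ M, ContinuousOn (ControlledResNet.interpKernel φ σa σA σb (D M) x y)
            (Set.Icc 0 1)) ∧
          TendstoUniformlyOn (fun M => ControlledResNet.interpKernel φ σa σA σb (D M) x y)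
            (κ x y) Filter.atTop (Set.Icc 0 1)) := by
  obtain ⟨C, c, hφ⟩ := ControlledResNet.exists_expLipschitz hlin hac
  refine ⟨ControlledResNet.limitKernel φ σa σA σb, fun x y => ?_, fun x y => ?_,
    fun D hD x y => ?_⟩
  · have h := ControlledResNet.isKernelSolution_limitKernel hlin hφ hσa σA σb x y
    exact ⟨ControlledResNet.continuousOn_limitKernel hlin hφ hσa σA σb x y, h,
      fun _ _ _ hk => hk.eqOn hφ hσa h⟩
  · obtain ⟨R, hR, hm⟩ :=
      ControlledResNet.exists_interpKernel_mem_PSD2 σa σA σb hlin hφ hσa x y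
    exact ⟨R, hR, fun t ht => ControlledResNet.limitKernel_mem_PSD2 hlin hφ hσa hm ht, hm⟩
  · exact ⟨fun M => ControlledResNet.continuousOn_interpKernel φ σa σA σb (D M) x y,
      ControlledResNet.tendstoUniformlyOn_interpKernel hlin hφ hσa σA σb x y hD⟩
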